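/- Let $U\subset\mathbb C$ be a simply connected domain. Let $\Phi\in L^1_{loc}(U)$ be piecewise analytic with canonical decomposition given by pairwise distinct analytic functions $A_1,\dots,A_r$ on $U$. This means that, with supports taken in the sense of distributions on $U$, the set $\bigcap_{i=1}^r \operatorname{supp}(\Phi-A_i)$ has Lebesgue measure $0$; put $M_i=U\setminus\operatorname{supp}(\Phi-A_i)$, the largest open subset of $U$ on which $\Phi=A_i$ almost everywhere. For $p\in U$ let $I(p)=\{j : p\in\overline{M_j}\}$. Let $f_i$ be an analytic function on $U$ with $f_i'=A_i$, put $H_j(z)=\operatorname{Re}\int_p^z A_j(w)\,dw=\operatorname{Re}(f_j(z)-f_j(p))$, and $\phi_p(z)=\max_{j\in I(p)}H_j(z)$ for $z\in U$. For $k\in I(p)$, when $I(p)$ has more than one element, let $$V_k(p)=\Big\{\sum_{j\in I(p)\setminus\{k\}}\theta_j\,(A_k(p)-A_j(p)) \;:\; \theta_j\ge 0 \text{ for all } j,\ \sum_{j\in I(p)\setminus\{k\}}\theta_j>0\Big\}.$$ **Theorem.** Assume that $\partial_{\bar z}\Phi\ge 0$ in the sense of distributions on $U$ (that is, $\Phi\in\Sigma(U)$),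 and that 1. for all $j<k<l$ the set $\partial M_j\cap\partial M_k\cap\partial M_l$ (boundaries taken in $U$) has one-dimensional Hausdorff measure $0$; 2. for every $p\in U$ such that $I(p)$ has more than one element, and every $k\in I(p)$, one has $0\notin V_k(p)$. Then every $p\in U$ has an open neighbourhood $N\subset U$ in which $\Phi=2\,\partial_z\phi_p$ almost everywhere, where $\partial_z\phi_p$ is the distributional derivative, which is given by a locally integrable function on $N$. -/

import Mathlib

open MeasureTheory TopologicalSpace
open scoped Distributions LineDeriv

/-- The distribution `ψ ↦ ∫ ψ g` on `U` defined by a function `g` that is locally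
integrable on `U` (it is `0`, by convention, if `g` is not locally integrable on `U`). -/
noncomputable def functionDistribution (U : Opens ℂ) (g : ℂ → ℂ) : 𝓓'(U, ℂ) :=
  (TestFunction.integralAgainstBilinCLM (ContinuousLinearMap.lsmul ℝ ℝ) volume g :
    𝓓(U, ℝ) →L[ℝ] ℂ)

/-- The distributional derivative `∂T/∂z = (∂T/∂x - i ∂T/∂y) / 2`. -/
noncomputable def distribDz {U : Opens ℂ} (T : 𝓓'(U, ℂ)) : 𝓓'(U, ℂ) :=
  (1 / 2 : ℂ) • (∂_{(1 : ℂ)} T - Complex.I • ∂_{Complex.I} T)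

/-- The distributional derivative `∂T/∂z̄ = (∂T/∂x + i ∂T/∂y) / 2`. -/
noncomputable def distribDzBar {U : Opens ℂ} (T : 𝓓'(U, ℂ)) : 𝓓'(U, ℂ) :=
  (1 / 2 : ℂ) • (∂_{(1 : ℂ)} T + Complex.I • ∂_{Complex.I} T)

/-- A complex distribution is `≥ 0` if it takes real nonnegative values on nonnegative test
functions. -/
def IsNonnegDistribution {U : Opens ℂ} (T : 𝓓'(U, ℂ)) : Prop :=
  ∀ ψ : 𝓓(U, ℝ), (∀ z, 0 ≤ ψ z) → 0 ≤ (T ψ).re ∧ (T ψ).im = 0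

/-- `Σ(U)`, the set of distributions `T` on `U` with `∂T/∂z̄ ≥ 0`. -/
def SigmaClass (U : Opens ℂ) : Set 𝓓'(U, ℂ) :=
  {T | IsNonnegDistribution (distribDzBar T)}

/-- The distributional support in `U` of the difference `Φ - B`. -/
noncomputable def diffSupport (U : Opens ℂ) (Φ B : ℂ → ℂ) : Set ℂ :=
  (U : Set ℂ) ∩ Distribution.dsupport (functionDistribution U (fun z => Φ z - B z))

/-- `U ∖ supp (Φ - B)`: the largest open subset of `U` on which `Φ = B`. -/
noncomputable def canonicalPiece (U : Opens ℂ) (Φ B : ℂ → ℂ) : Set ℂ :=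
  (U : Set ℂ) \ diffSupport U Φ B

/-- `Φ` is piecewise analytic in `U`, with canonical decomposition given by the pairwise distinct
analytic functions `A i` on `U` (and by the sets `canonicalPiece U Φ (A i)`):
the set `⋂ i, supp (Φ - A i)` is Lebesgue negligible. -/
structure IsCanonicalPA (U : Opens ℂ) (Φ : ℂ → ℂ) {r : ℕ} (A : Fin r → ℂ → ℂ) : Prop where
  locallyIntegrable : LocallyIntegrableOn Φ (U : Set ℂ) volume
  analytic : ∀ i, DifferentiableOn ℂ (A i) (U : Set ℂ)
  distinct : ∀ i j, i ≠ j → ¬ Set.EqOn (A i) (A j) (U : Set ℂ)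
  negligible : volume ((U : Set ℂ) ∩ ⋂ i, diffSupport U Φ (A i)) = 0

open Classical in
/-- `I(p)`, the set of the indices `j` such that `p` lies in the closure of the `j`-th piece. -/
noncomputable def activeIndices (U : Opens ℂ) (Φ : ℂ → ℂ) {r : ℕ} (A : Fin r → ℂ → ℂ) (p : ℂ) :
    Finset (Fin r) :=
  Finset.univ.filter fun j => p ∈ closure (canonicalPiece U Φ (A j))

/-- The cone `V_k(p)` of the combinations `∑ θ_j (A_k(p) - A_j(p))`, over `j ∈ I(p) ∖ {k}`, with
coefficients `θ_j ≥ 0` of positive sum. -/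
def differenceCone (U : Opens ℂ) (Φ : ℂ → ℂ) {r : ℕ} (A : Fin r → ℂ → ℂ) (p : ℂ) (k : Fin r) :
    Set ℂ :=
  {v | ∃ θ : Fin r → ℝ, (∀ j ∈ (activeIndices U Φ A p).erase k, 0 ≤ θ j) ∧
    0 < ∑ j ∈ (activeIndices U Φ A p).erase k, θ j ∧
    v = ∑ j ∈ (activeIndices U Φ A p).erase k, (θ j : ℂ) * (A k p - A j p)}

/-- `H_j(z) = Re ∫_p^z A_j(w) dw = Re (f_j(z) - f_j(p))`, where `f` is a primitive of `A_j`. -/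
def harmonicFromPrimitive (f : ℂ → ℂ) (p z : ℂ) : ℝ :=
  (f z - f p).re

/-- `φ_p(z) = max_{j ∈ I} H_j(z)` for a finite non-empty set `I` of indices. -/
noncomputable def maxHarmonic {r : ℕ} (I : Finset (Fin r)) (f : Fin r → ℂ → ℂ) (p z : ℂ) : ℝ :=
  ⨆ j : I, harmonicFromPrimitive (f j) p z

/-- In `N`, the distribution `∂φ/∂z` is given by a locally integrable function `g`,
and `Φ = 2 g` almost everywhere in `N`. -/
def AEEqTwoDz (N : Opens ℂ) (Φ : ℂ → ℂ) (φ : ℂ → ℝ) : Prop :=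
  ∃ g : ℂ → ℂ, LocallyIntegrableOn g (N : Set ℂ) volume ∧
    functionDistribution N g = distribDz (functionDistribution N fun z => (φ z : ℂ)) ∧
    ∀ᵐ z ∂(volume.restrict (N : Set ℂ)), Φ z = 2 * g z

/-! It suffices to show that, near `p`, on a piece `M k` adherent to `p` the function `H_k`
dominates all `H_j`, `j ∈ I(p)`. Then `φ_p = H_k` on `M k`, so the derivative of `φ_p` in direction
`v` is `Re (A k · v) = Re (Φ v)` almost everywhere. Since `φ_p` is Lipschitz, integration by parts
turns this into `Φ = 2 ∂φ_p/∂z`.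

Geometry of the pieces. By condition 2 and separation of convex sets there is, for each `k ∈ I(p)`,
a direction `v k` with `Re ((A k - A j) v k) > 0` at `p` for all other active `j`; by continuity
this persists near `p` and for nearby directions. Where only `M k` and `M j` occur, `Φ - A j = (A k
- A j) 1_{M k}`, and testing `∂Φ/∂z̄ ≥ 0` against `ψ · conj v / (A k - A j)` shows that `1_{M k}` is
nondecreasing in direction `v` (`integral_indicator_fderiv_nonpos`). Hence `M k` absorbs forward
translations along `v`. By condition 1 almost every line parallel to `v` misses the points where
three boundaries meet, so this remains true near `p` with any number of pieces (`add_mul_mem`).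
Consequently `M k` contains, near `p`, an open cone with vertex `p` around the direction `v k`.

Comparison. As `∂Φ/∂z̄` is real, the form `Re (Φ dz)` is closed, and after mollification it has a
primitive `Ψ`. On `M k` the function `Ψ - Re f_k` is locally constant, while `Ψ - Re f_j` is
nonincreasing in direction `v j`. For `z ∈ M k`, one reaches `p` from `z` inside `M k` by way of `z
+ s v k`, and from `z + s v j` inside `M j`. Comparing the increments of `Ψ` gives `H_j(z) ≤ H_k(z)`
(`re_primitive_sub_le`, `exists_ball_re_primitive_le`). The mollification parameter tends to `0`
first; the endpoints of the two paths tend to `p` afterwards, with an error controlled by a local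
bound for `|Φ|`. -/

/-! ### The canonical pieces as a maximal partition -/

/-- The open sets `M i` are the largest open subsets of `U` on which `Φ = A i` almost everywhere;
they are pairwise disjoint and cover almost all of `U`. -/
structure IsMaximalPartition {ι : Type*} (U : Set ℂ) (Φ : ℂ → ℂ) (A : ι → ℂ → ℂ)
    (M : ι → Set ℂ) : Prop where
  isOpen : ∀ i, IsOpen (M i)
  subset : ∀ i, M i ⊆ U
  ae_eq : ∀ i, ∀ᵐ z, z ∈ M i → Φ z = A i z
  maximal : ∀ i (V : Set ℂ), IsOpen V → V ⊆ U → (∀ᵐ z, z ∈ V → Φ z = A i z) → V ⊆ M i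
  ae_cover : ∀ᵐ z, z ∈ U → ∃ i, z ∈ M i
  disjoint : ∀ i j, i ≠ j → Disjoint (M i) (M j)

theorem functionDistribution_apply {U : Opens ℂ} {g : ℂ → ℂ}
    (hg : LocallyIntegrableOn g (U : Set ℂ) volume) (ψ : 𝓓(U, ℝ)) :
    functionDistribution U g ψ = ∫ z, ψ z • g z :=
  TestFunction.integralAgainstBilinCLM_eq_integral hg

theorem canonicalPiece_eq (U : Opens ℂ) (Φ B : ℂ → ℂ) :
    canonicalPiece U Φ B =
      (U : Set ℂ) \ Distribution.dsupport (functionDistribution U (fun z => Φ z - B z)) := by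
  simp [canonicalPiece, diffSupport]

theorem isOpen_canonicalPiece (U : Opens ℂ) (Φ B : ℂ → ℂ) : IsOpen (canonicalPiece U Φ B) := by
  rw [canonicalPiece_eq]
  exact U.isOpen.sdiff Distribution.isClosed_dsupport

/-- Locally this is the fundamental lemma of the calculus of variations. The exceptional set is then
locally null, hence null because the plane is second countable. -/
theorem ae_eq_on_canonicalPiece {U : Opens ℂ} {Φ B : ℂ → ℂ}
    (h : LocallyIntegrableOn (fun z => Φ z - B z) (U : Set ℂ) volume) :
    ∀ᵐ z, z ∈ canonicalPiece U Φ B → Φ z = B z := by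
  rw [ae_iff]
  refine measure_null_of_locally_null _ fun x hx => ?_
  simp only [Set.mem_ofPred_eq, Classical.not_imp, canonicalPiece_eq] at hx
  obtain ⟨s, hs, hso, hxs⟩ := (Distribution.notMem_dsupport_iff x).1 hx.1.2
  have hloc : ∀ᵐ z, z ∈ s ∩ (U : Set ℂ) → Φ z - B z = 0 := by
    refine IsOpen.ae_eq_zero_of_integral_contDiff_smul_eq_zero (hso.inter U.isOpen)
      (h.mono_set Set.inter_subset_right) fun g hg hgc hgs => ?_
    have := hs ⟨g, hg, hgc, hgs.trans Set.inter_subset_right⟩ (hgs.trans Set.inter_subset_left)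
    rwa [functionDistribution_apply h] at this
  refine ⟨s ∩ U ∩ {z | ¬ (z ∈ canonicalPiece U Φ B → Φ z = B z)}, ?_, ?_⟩
  · exact Filter.inter_mem (mem_nhdsWithin_of_mem_nhds
      ((hso.inter U.isOpen).mem_nhds ⟨hxs, hx.1.1⟩)) self_mem_nhdsWithin
  · refine measure_mono_null ?_ (ae_iff.1 hloc)
    rintro z ⟨hz, hz'⟩
    simp only [Set.mem_ofPred_eq, Classical.not_imp] at hz' ⊢
    exact ⟨hz, fun h0 => hz'.2 (sub_eq_zero.1 h0)⟩

theorem subset_canonicalPiece {U : Opens ℂ} {Φ B : ℂ → ℂ}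
    (h : LocallyIntegrableOn (fun z => Φ z - B z) (U : Set ℂ) volume) {V : Set ℂ} (hV : IsOpen V)
    (hVU : V ⊆ U) (hae : ∀ᵐ z, z ∈ V → Φ z = B z) : V ⊆ canonicalPiece U Φ B := by
  intro x hx
  rw [canonicalPiece_eq]
  refine ⟨hVU hx, (Distribution.notMem_dsupport_iff x).2 ⟨V, fun ψ hψ => ?_, hV, hx⟩⟩
  rw [functionDistribution_apply h]
  refine integral_eq_zero_of_ae ?_
  filter_upwards [hae] with z hz
  by_cases hzV : z ∈ V
  · simp [hz hzV]
  · simp [image_eq_zero_of_notMem_tsupport fun h => hzV (hψ h)]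

/-- Disjointness is the identity theorem: two analytic functions agreeing almost everywhere on a
nonempty open set agree on all of the connected set `U`, contrary to distinctness. -/
theorem IsCanonicalPA.isMaximalPartition {U : Opens ℂ} (hU : IsPreconnected (U : Set ℂ))
    {Φ : ℂ → ℂ} {r : ℕ} {A : Fin r → ℂ → ℂ} (h : IsCanonicalPA U Φ A) :
    IsMaximalPartition (U : Set ℂ) Φ A (fun i => canonicalPiece U Φ (A i)) := by
  have hloc : ∀ i, LocallyIntegrableOn (fun z => Φ z - A i z) (U : Set ℂ) volume := fun i =>
    h.locallyIntegrable.sub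
      ((h.analytic i).continuousOn.locallyIntegrableOn U.isOpen.measurableSet)
  have hae := fun i => ae_eq_on_canonicalPiece (hloc i)
  have hopen := fun i => isOpen_canonicalPiece U Φ (A i)
  have hsub : ∀ i, canonicalPiece U Φ (A i) ⊆ (U : Set ℂ) := fun i => Set.sdiff_subset
  refine ⟨hopen, hsub, hae, fun i V hV hVU hVae => subset_canonicalPiece (hloc i) hV hVU hVae,
    ?_, fun i j hij => ?_⟩
  · rw [ae_iff]
    refine measure_mono_null ?_ h.negligible
    intro z hz
    simp only [Set.mem_ofPred_eq, Classical.not_imp, not_exists] at hz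
    refine ⟨hz.1, Set.mem_iInter.2 fun i => ?_⟩
    by_contra hzi
    exact hz.2 i ⟨hz.1, hzi⟩
  · rw [Set.disjoint_left]
    intro x hxi hxj
    refine h.distinct i j hij ?_
    have hW : IsOpen (canonicalPiece U Φ (A i) ∩ canonicalPiece U Φ (A j)) :=
      (hopen i).inter (hopen j)
    have heq : Set.EqOn (A i) (A j) (canonicalPiece U Φ (A i) ∩ canonicalPiece U Φ (A j)) := by
      refine Measure.eqOn_open_of_ae_eq (μ := volume) ?_ hW
        ((h.analytic i).continuousOn.mono (Set.inter_subset_left.trans (hsub i)))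
        ((h.analytic j).continuousOn.mono (Set.inter_subset_left.trans (hsub i)))
      rw [Filter.EventuallyEq, ae_restrict_iff' hW.measurableSet]
      filter_upwards [hae i, hae j] with z hi hj hz
      rw [← hi hz.1, ← hj hz.2]
    exact ((h.analytic i).analyticOnNhd U.isOpen).eqOn_of_preconnected_of_eventuallyEq
      ((h.analytic j).analyticOnNhd U.isOpen) hU (hsub i hxi)
      (Filter.eventuallyEq_of_mem (hW.mem_nhds ⟨hxi, hxj⟩) heq)

namespace IsMaximalPartition

variable {ι : Type*} {U : Set ℂ} {Φ : ℂ → ℂ} {A : ι → ℂ → ℂ} {M : ι → Set ℂ}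

/-- The pieces cover almost everything, so `Φ = A k` almost everywhere on `V`, and maximality
applies. This is how membership in `M k` is recovered from almost-everywhere information. -/
theorem subset_of_forall_disjoint (h : IsMaximalPartition U Φ A M) {k : ι} {V : Set ℂ}
    (hV : IsOpen V) (hVU : V ⊆ U) (hd : ∀ j, j ≠ k → Disjoint V (M j)) : V ⊆ M k := by
  refine h.maximal k V hV hVU ?_
  filter_upwards [h.ae_cover, h.ae_eq k] with z hz hzk hzV
  obtain ⟨i, hi⟩ := hz (hVU hzV)
  by_cases hik : i = k
  · exact hzk (hik ▸ hi)
  · exact absurd hi (Set.disjoint_left.1 (hd i hik) hzV)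

theorem eq_of_mem_of_mem_closure (h : IsMaximalPartition U Φ A M) {i j : ι} {z : ℂ}
    (hi : z ∈ M i) (hj : z ∈ closure (M j)) : i = j := by
  by_contra hij
  obtain ⟨w, hw, hw'⟩ := mem_closure_iff.1 hj (M i) (h.isOpen i) hi
  exact Set.disjoint_left.1 (h.disjoint i j hij) hw hw'

theorem exists_mem_closure [Finite ι] (h : IsMaximalPartition U Φ A M) (hU : IsOpen U) {p : ℂ}
    (hp : p ∈ U) : ∃ i, p ∈ closure (M i) := by
  by_contra! hcon
  set V := U ∩ ⋂ i, (closure (M i))ᶜ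
  have hV : IsOpen V := hU.inter (isOpen_iInter_of_finite fun i => isClosed_closure.isOpen_compl)
  have hpV : p ∈ V := ⟨hp, Set.mem_iInter.2 hcon⟩
  refine (hV.measure_pos volume ⟨p, hpV⟩).ne' (measure_mono_null ?_ (ae_iff.1 h.ae_cover))
  intro z hz
  simp only [Set.mem_ofPred_eq, Classical.not_imp, not_exists]
  exact ⟨hz.1, fun i hi => Set.mem_iInter.1 hz.2 i (subset_closure hi)⟩

end IsMaximalPartition

/-! ### The operator `∂/∂z̄` and integration by parts -/

/-- The derivative `∂θ/∂z̄` of a function that is differentiable in the real sense. -/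
noncomputable def dbar (θ : ℂ → ℂ) (z : ℂ) : ℂ :=
  (fderiv ℝ θ z 1 + Complex.I * fderiv ℝ θ z Complex.I) / 2

/-- The value at `θ` of the distribution `∂Φ/∂z̄`, for complex test functions `θ`. -/
noncomputable def dbarPairing (Φ θ : ℂ → ℂ) : ℂ :=
  -∫ z, dbar θ z * Φ z

theorem integrable_mul_of_tsupport_subset {U : Set ℂ} {θ g : ℂ → ℂ} (hθ : Continuous θ)
    (hθc : HasCompactSupport θ) (hθU : tsupport θ ⊆ U) (hg : LocallyIntegrableOn g U volume) :
    Integrable (fun z => θ z * g z) := by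
  have h : IntegrableOn (fun z => θ z * g z) (tsupport θ) volume :=
    (hg.integrableOn_compact_subset hθU hθc).continuousOn_mul hθ.continuousOn hθc
  rwa [integrableOn_iff_integrable_of_support_subset] at h
  intro z hz
  refine subset_tsupport θ fun h0 => hz ?_
  simp [h0]

theorem continuous_fderiv_apply_of_contDiff {θ : ℂ → ℂ} (hθ : ContDiff ℝ 1 θ) (v : ℂ) :
    Continuous fun z => fderiv ℝ θ z v :=
  (hθ.continuous_fderiv one_ne_zero).clm_apply continuous_const

theorem integrable_fderiv_apply_mul {U : Set ℂ} {θ g : ℂ → ℂ} (hθ : ContDiff ℝ 1 θ)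
    (hθc : HasCompactSupport θ) (hθU : tsupport θ ⊆ U) (hg : LocallyIntegrableOn g U volume)
    (v : ℂ) : Integrable (fun z => fderiv ℝ θ z v * g z) :=
  integrable_mul_of_tsupport_subset (continuous_fderiv_apply_of_contDiff hθ v)
    (hθc.fderiv_apply ℝ v) ((tsupport_fderiv_apply_subset ℝ v).trans hθU) hg

theorem dbar_mul_eq (θ g : ℂ → ℂ) (z : ℂ) : dbar θ z * g z =
    (1 / 2 : ℂ) * (fderiv ℝ θ z 1 * g z) +
      (Complex.I / 2) * (fderiv ℝ θ z Complex.I * g z) := by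
  unfold dbar; ring

theorem integrable_dbar_mul {U : Set ℂ} {θ g : ℂ → ℂ} (hθ : ContDiff ℝ 1 θ)
    (hθc : HasCompactSupport θ) (hθU : tsupport θ ⊆ U) (hg : LocallyIntegrableOn g U volume) :
    Integrable (fun z => dbar θ z * g z) := by
  simp_rw [dbar_mul_eq]
  exact ((integrable_fderiv_apply_mul hθ hθc hθU hg 1).const_mul _).add
    ((integrable_fderiv_apply_mul hθ hθc hθU hg Complex.I).const_mul _)

theorem integral_dbar_mul {U : Set ℂ} {θ g : ℂ → ℂ} (hθ : ContDiff ℝ 1 θ)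
    (hθc : HasCompactSupport θ) (hθU : tsupport θ ⊆ U) (hg : LocallyIntegrableOn g U volume) :
    ∫ z, dbar θ z * g z = ((∫ z, fderiv ℝ θ z 1 * g z) +
      Complex.I * ∫ z, fderiv ℝ θ z Complex.I * g z) / 2 := by
  simp_rw [dbar_mul_eq]
  rw [integral_add ((integrable_fderiv_apply_mul hθ hθc hθU hg 1).const_mul _)
    ((integrable_fderiv_apply_mul hθ hθc hθU hg Complex.I).const_mul _),
    integral_const_mul, integral_const_mul]
  ring

/-- Integration by parts against a holomorphic function. -/
theorem integral_fderiv_apply_mul_holomorphic {U : Set ℂ} (hU : IsOpen U) {θ g g' : ℂ → ℂ}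
    (hθ : ContDiff ℝ 1 θ) (hθc : HasCompactSupport θ) (hθU : tsupport θ ⊆ U)
    (hg : ∀ z ∈ U, HasDerivAt g (g' z) z) (hg' : ContinuousOn g' U) (v : ℂ) :
    ∫ z, fderiv ℝ θ z v * g z = -∫ z, θ z * (g' z * v) := by
  have hgc : ContinuousOn g U := fun z hz => (hg z hz).continuousAt.continuousWithinAt
  have hfd : ∀ z ∈ U, HasFDerivAt g
      ((ContinuousLinearMap.toSpanSingleton ℂ (g' z)).restrictScalars ℝ) z := fun z hz =>
    (hg z hz).hasFDerivAt.restrictScalars ℝ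
  have heq : ∀ z, θ z * fderiv ℝ g z v = θ z * (g' z * v) := by
    intro z
    by_cases hz : z ∈ tsupport θ
    · rw [(hfd z (hθU hz)).fderiv]
      simp [mul_comm]
    · simp [image_eq_zero_of_notMem_tsupport hz]
  have h2 : Integrable (fun z => θ z * (g' z * v)) :=
    integrable_mul_of_tsupport_subset hθ.continuous hθc hθU
      ((hg'.mul continuousOn_const).locallyIntegrableOn hU.measurableSet)
  have key := integral_mul_fderiv_eq_neg_fderiv_mul_of_integrable (μ := volume) (f := θ) (g := g)
    (v := v)
    (integrable_fderiv_apply_mul hθ hθc hθU (hgc.locallyIntegrableOn hU.measurableSet) v)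
    (by simpa only [heq] using h2)
    (integrable_mul_of_tsupport_subset hθ.continuous hθc hθU
      (hgc.locallyIntegrableOn hU.measurableSet))
    (fun z _ => hθ.differentiable one_ne_zero z)
    (fun z hz => (hfd z (hθU hz)).differentiableAt)
  simp only [heq] at key
  rw [key, neg_neg]

theorem integral_dbar_mul_holomorphic {U : Set ℂ} (hU : IsOpen U) {θ g : ℂ → ℂ}
    (hθ : ContDiff ℝ 1 θ) (hθc : HasCompactSupport θ) (hθU : tsupport θ ⊆ U)
    (hg : DifferentiableOn ℂ g U) : ∫ z, dbar θ z * g z = 0 := by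
  have h1 : ∀ z ∈ U, HasDerivAt g (deriv g z) z := fun z hz =>
    (hg.differentiableAt (hU.mem_nhds hz)).hasDerivAt
  have h2 : ContinuousOn (deriv g) U := (hg.deriv hU).continuousOn
  rw [integral_dbar_mul hθ hθc hθU (hg.continuousOn.locallyIntegrableOn hU.measurableSet),
    integral_fderiv_apply_mul_holomorphic hU hθ hθc hθU h1 h2,
    integral_fderiv_apply_mul_holomorphic hU hθ hθc hθU h1 h2]
  simp_rw [← mul_assoc]
  rw [integral_mul_const, integral_mul_const]
  linear_combination (1 / 2 : ℂ) * (-(∫ z, θ z * deriv g z)) * Complex.I_mul_I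

theorem dbarPairing_add {U : Set ℂ} {Φ θ₁ θ₂ : ℂ → ℂ} (hΦ : LocallyIntegrableOn Φ U volume)
    (h₁ : ContDiff ℝ 1 θ₁) (hc₁ : HasCompactSupport θ₁) (hU₁ : tsupport θ₁ ⊆ U)
    (h₂ : ContDiff ℝ 1 θ₂) (hc₂ : HasCompactSupport θ₂) (hU₂ : tsupport θ₂ ⊆ U) :
    dbarPairing Φ (fun z => θ₁ z + θ₂ z) = dbarPairing Φ θ₁ + dbarPairing Φ θ₂ := by
  unfold dbarPairing
  rw [← neg_add, ← integral_add (integrable_dbar_mul h₁ hc₁ hU₁ hΦ)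
    (integrable_dbar_mul h₂ hc₂ hU₂ hΦ)]
  congr 2 with z
  unfold dbar
  rw [fderiv_fun_add (h₁.differentiable one_ne_zero z) (h₂.differentiable one_ne_zero z)]
  simp only [add_apply]
  ring

theorem dbarPairing_const_mul {Φ θ : ℂ → ℂ} (h : ContDiff ℝ 1 θ) (c : ℂ) :
    dbarPairing Φ (fun z => c * θ z) = c * dbarPairing Φ θ := by
  unfold dbarPairing
  rw [mul_neg, ← integral_const_mul]
  congr 2 with z
  unfold dbar
  rw [fderiv_const_mul (h.differentiable one_ne_zero z)]
  simp only [smul_apply, smul_eq_mul]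
  ring

theorem fderiv_ofReal_comp {ψ : ℂ → ℝ} {z : ℂ} (h : DifferentiableAt ℝ ψ z) (v : ℂ) :
    fderiv ℝ (fun z => (ψ z : ℂ)) z v = (fderiv ℝ ψ z v : ℂ) := by
  have := (Complex.ofRealCLM.hasFDerivAt (x := ψ z)).comp z h.hasFDerivAt
  rw [show (fun z => (ψ z : ℂ)) = Complex.ofRealCLM ∘ ψ from rfl, this.fderiv]
  rfl

theorem contDiff_ofReal_comp {ψ : ℂ → ℝ} {n : WithTop ℕ∞} (h : ContDiff ℝ n ψ) :
    ContDiff ℝ n (fun z => (ψ z : ℂ)) :=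
  Complex.ofRealCLM.contDiff.comp h

theorem tsupport_ofReal_comp_subset (ψ : ℂ → ℝ) :
    tsupport (fun z => (ψ z : ℂ)) ⊆ tsupport ψ :=
  tsupport_comp_subset Complex.ofReal_zero ψ

theorem hasCompactSupport_ofReal_comp {ψ : ℂ → ℝ} (h : HasCompactSupport ψ) :
    HasCompactSupport (fun z => (ψ z : ℂ)) :=
  h.comp_left Complex.ofReal_zero

/-! ### Positivity of `∂Φ/∂z̄` against complex test functions -/

/-- `∂Φ/∂z̄` is a nonnegative distribution on `U`, in terms of unbundled test functions. -/
def DbarNonneg (U : Set ℂ) (Φ : ℂ → ℂ) : Prop :=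
  ∀ ψ : ℂ → ℝ, ContDiff ℝ (⊤ : ℕ∞) ψ → HasCompactSupport ψ → tsupport ψ ⊆ U → (∀ z, 0 ≤ ψ z) →
    0 ≤ (dbarPairing Φ fun z => (ψ z : ℂ)).re ∧ (dbarPairing Φ fun z => (ψ z : ℂ)).im = 0

theorem dbarNonneg_of_mem_sigmaClass {U : Opens ℂ} {Φ : ℂ → ℂ}
    (hloc : LocallyIntegrableOn Φ (U : Set ℂ) volume)
    (h : functionDistribution U Φ ∈ SigmaClass U) : DbarNonneg (U : Set ℂ) Φ := by
  intro ψ hψ hψc hψU hψ0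
  let ψ' : 𝓓(U, ℝ) := ⟨ψ, hψ, hψc, hψU⟩
  have hψ1 : ContDiff ℝ 1 ψ := hψ.of_le (by exact_mod_cast le_top)
  have hd : ∀ v : ℂ, (∂_{v} (functionDistribution U Φ)) ψ' =
      -∫ z, fderiv ℝ (fun z => (ψ z : ℂ)) z v * Φ z := by
    intro v
    rw [Distribution.lineDerivOp_apply_apply, map_neg, functionDistribution_apply hloc]
    congr 2 with z
    rw [fderiv_ofReal_comp (hψ1.differentiable one_ne_zero z)]
    have : (∂_{v} ψ') z = fderiv ℝ ψ z v := by
      rw [TestFunction.lineDerivOp_eq_lineDerivCLM ℝ, TestFunction.lineDerivCLM_eq_fderivCLM,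
        TestFunction.fderivCLM_apply_of_le _ (by simp)]
      rfl
    rw [this, Complex.real_smul]
  have heq : dbarPairing Φ (fun z => (ψ z : ℂ)) = distribDzBar (functionDistribution U Φ) ψ' := by
    have : distribDzBar (functionDistribution U Φ) ψ' = (1 / 2 : ℂ) •
        ((∂_{(1 : ℂ)} (functionDistribution U Φ)) ψ' +
          Complex.I • (∂_{Complex.I} (functionDistribution U Φ)) ψ') := rfl
    rw [this, hd, hd, dbarPairing, integral_dbar_mul (contDiff_ofReal_comp hψ1)
      (hasCompactSupport_ofReal_comp hψc) ((tsupport_ofReal_comp_subset ψ).trans hψU) hloc]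
    simp only [smul_eq_mul]
    ring
  rw [heq]
  exact h ψ' hψ0

theorem contDiff_mul_of_tsupport_subset {V : Set ℂ} (hV : IsOpen V) {n : WithTop ℕ∞}
    {g ψ : ℂ → ℝ} (hg : ContDiffOn ℝ n g V) (hψ : ContDiff ℝ n ψ) (hψV : tsupport ψ ⊆ V) :
    ContDiff ℝ n (fun z => g z * ψ z) := by
  rw [contDiff_iff_contDiffAt]
  intro z
  by_cases hz : z ∈ V
  · exact (hg.contDiffAt (hV.mem_nhds hz)).mul hψ.contDiffAt
  · have : (fun z => g z * ψ z) =ᶠ[nhds z] fun _ => 0 := by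
      filter_upwards [(isClosed_tsupport ψ).isOpen_compl.mem_nhds fun h => hz (hψV h)] with w hw
      simp [image_eq_zero_of_notMem_tsupport hw]
    exact contDiffAt_const.congr_of_eventuallyEq this

/-- The test function `g ψ` may change sign, but `(g + C) ψ` is nonnegative when `C` bounds `|g|` on
the support of `ψ`, and the pairings with `(g + C) ψ` and `C ψ` are real. -/
theorem DbarNonneg.im_mul_eq_zero {U : Set ℂ} {Φ : ℂ → ℂ} (h : DbarNonneg U Φ)
    (hΦ : LocallyIntegrableOn Φ U volume) {V : Set ℂ} (hV : IsOpen V) (hVU : V ⊆ U)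
    {g ψ : ℂ → ℝ} (hg : ContDiffOn ℝ (⊤ : ℕ∞) g V) (hψ : ContDiff ℝ (⊤ : ℕ∞) ψ)
    (hψc : HasCompactSupport ψ) (hψV : tsupport ψ ⊆ V) (hψ0 : ∀ z, 0 ≤ ψ z) :
    (dbarPairing Φ fun z => ((g z * ψ z : ℝ) : ℂ)).im = 0 := by
  obtain ⟨C, hC⟩ := hψc.isCompact.exists_bound_of_continuousOn (hg.continuousOn.mono hψV)
  have hgψ := contDiff_mul_of_tsupport_subset hV hg hψ hψV
  have hsub : tsupport (fun z => g z * ψ z) ⊆ tsupport ψ := tsupport_mul_subset_right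
  have hgψc : HasCompactSupport (fun z => g z * ψ z) := hψc.mul_left
  have hCψ : ContDiff ℝ (⊤ : ℕ∞) (fun z => C * ψ z) := contDiff_const.mul hψ
  have hCsub : tsupport (fun z => C * ψ z) ⊆ tsupport ψ := tsupport_mul_subset_right
  have hCψc : HasCompactSupport (fun z => C * ψ z) := hψc.mul_left
  have h1 : ∀ {φ : ℂ → ℝ}, ContDiff ℝ (⊤ : ℕ∞) φ → ContDiff ℝ 1 (fun z => (φ z : ℂ)) :=
    fun hφ => contDiff_ofReal_comp (hφ.of_le (by exact_mod_cast le_top))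
  have hsum : (dbarPairing Φ fun z => ((g z * ψ z + C * ψ z : ℝ) : ℂ)) =
      dbarPairing Φ (fun z => ((g z * ψ z : ℝ) : ℂ)) + C * dbarPairing Φ fun z => (ψ z : ℂ) := by
    rw [← dbarPairing_const_mul (h1 hψ), ← dbarPairing_add hΦ (h1 hgψ)
      (hasCompactSupport_ofReal_comp hgψc)
      ((tsupport_ofReal_comp_subset _).trans (hsub.trans (hψV.trans hVU)))]
    · simp
    · simpa using h1 hCψ
    · simpa using hasCompactSupport_ofReal_comp hCψc
    · simpa using (tsupport_ofReal_comp_subset _).trans (hCsub.trans (hψV.trans hVU))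
  have hs := (h _ (hgψ.add hCψ) (hgψc.add hCψc)
    ((tsupport_add _ _).trans (Set.union_subset (hsub.trans (hψV.trans hVU))
      (hCsub.trans (hψV.trans hVU)))) fun z => ?_).2
  · have hψim := (h ψ hψ hψc (hψV.trans hVU) hψ0).2
    rw [hsum] at hs
    simpa [hψim] using hs
  · rw [← add_mul]
    by_cases hz : z ∈ tsupport ψ
    · refine mul_nonneg ?_ (hψ0 z)
      have := abs_le.1 (hC z hz)
      linarith
    · simp [image_eq_zero_of_notMem_tsupport hz]

/-- The imaginary part of `H` contributes `I` times a real number, so only the nonnegative test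
function `Re H · ψ` matters for the real part. -/
theorem DbarNonneg.re_mul_nonneg {U : Set ℂ} {Φ : ℂ → ℂ} (h : DbarNonneg U Φ)
    (hΦ : LocallyIntegrableOn Φ U volume) {V : Set ℂ} (hV : IsOpen V) (hVU : V ⊆ U)
    {H : ℂ → ℂ} {ψ : ℂ → ℝ} (hH : ContDiffOn ℝ (⊤ : ℕ∞) H V) (hH0 : ∀ z ∈ V, 0 ≤ (H z).re)
    (hψ : ContDiff ℝ (⊤ : ℕ∞) ψ) (hψc : HasCompactSupport ψ) (hψV : tsupport ψ ⊆ V)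
    (hψ0 : ∀ z, 0 ≤ ψ z) : 0 ≤ (dbarPairing Φ fun z => H z * ψ z).re := by
  have h1 : ∀ {φ : ℂ → ℝ}, ContDiff ℝ (⊤ : ℕ∞) φ → ContDiff ℝ 1 (fun z => (φ z : ℂ)) :=
    fun hφ => contDiff_ofReal_comp (hφ.of_le (by exact_mod_cast le_top))
  have hre : ContDiffOn ℝ (⊤ : ℕ∞) (fun z => (H z).re) V :=
    Complex.reCLM.contDiff.comp_contDiffOn hH
  have him : ContDiffOn ℝ (⊤ : ℕ∞) (fun z => (H z).im) V :=
    Complex.imCLM.contDiff.comp_contDiffOn hH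
  have hG := contDiff_mul_of_tsupport_subset hV hre hψ hψV
  have hK := contDiff_mul_of_tsupport_subset hV him hψ hψV
  have hGc : HasCompactSupport (fun z => (H z).re * ψ z) := hψc.mul_left
  have hKc : HasCompactSupport (fun z => (H z).im * ψ z) := hψc.mul_left
  have hGs : tsupport (fun z => (H z).re * ψ z) ⊆ U :=
    tsupport_mul_subset_right.trans (hψV.trans hVU)
  have hKs : tsupport (fun z => (H z).im * ψ z) ⊆ U :=
    tsupport_mul_subset_right.trans (hψV.trans hVU)
  have hsum : (dbarPairing Φ fun z => H z * ψ z) =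
      dbarPairing Φ (fun z => (((H z).re * ψ z : ℝ) : ℂ)) +
        Complex.I * dbarPairing Φ fun z => (((H z).im * ψ z : ℝ) : ℂ) := by
    rw [← dbarPairing_const_mul (h1 hK), ← dbarPairing_add hΦ (h1 hG)
      (hasCompactSupport_ofReal_comp hGc) ((tsupport_ofReal_comp_subset _).trans hGs)
      (contDiff_const.mul (h1 hK)) (hasCompactSupport_ofReal_comp hKc).mul_left
      (tsupport_mul_subset_right.trans ((tsupport_ofReal_comp_subset _).trans hKs))]
    congr 1 with z
    conv_lhs => rw [← Complex.re_add_im (H z)]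
    push_cast
    ring
  have hG0 := (h _ hG hGc hGs fun z => ?_).1
  · rw [hsum, Complex.add_re, Complex.I_mul_re,
      h.im_mul_eq_zero hΦ hV hVU him hψ hψc hψV hψ0, neg_zero, add_zero]
    exact hG0
  · by_cases hz : z ∈ tsupport ψ
    · exact mul_nonneg (hH0 z (hψV hz)) (hψ0 z)
    · simp [image_eq_zero_of_notMem_tsupport hz]

/-! ### Differentiating pairings with translated test functions -/

theorem hasCompactSupport_comp_sub_right {E : Type*} [Zero E] {θ : ℂ → E}
    (h : HasCompactSupport θ) (x : ℂ) : HasCompactSupport (fun w => θ (w - x)) :=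
  h.comp_homeomorph (Homeomorph.subRight x)

/-- Differentiation of the pairing of a function with the translates of a test function. -/
theorem exists_hasFDerivAt_integral_translate {θ g : ℂ → ℂ} (hθ : ContDiff ℝ 1 θ)
    (hθc : HasCompactSupport θ) (hg : Integrable g) (x : ℂ) :
    ∃ L : ℂ →L[ℝ] ℂ, HasFDerivAt (fun x => ∫ w, θ (w - x) * g w) L x ∧
      ∀ v, L v = -∫ w, fderiv ℝ θ (w - x) v * g w := by
  obtain ⟨C, hC⟩ := (hθ.continuous_fderiv one_ne_zero).bounded_above_of_compact_support
    (hθc.fderiv ℝ)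
  obtain ⟨C₀, hC₀⟩ := hθ.continuous.bounded_above_of_compact_support hθc
  have hcont : ∀ y : ℂ, Continuous fun w => θ (w - y) := fun y =>
    hθ.continuous.comp (continuous_id.sub continuous_const)
  have hcont' : ∀ y : ℂ, Continuous fun w => fderiv ℝ θ (w - y) := fun y =>
    (hθ.continuous_fderiv one_ne_zero).comp (continuous_id.sub continuous_const)
  have hmeas : ∀ y : ℂ, AEStronglyMeasurable (fun w => g w • -fderiv ℝ θ (w - y)) volume :=
    fun y => hg.aestronglyMeasurable.smul (hcont' y).neg.aestronglyMeasurable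
  have hbound : ∀ w y : ℂ, ‖g w • -fderiv ℝ θ (w - y)‖ ≤ ‖g w‖ * C := fun w y => by
    rw [norm_smul, norm_neg]
    exact mul_le_mul_of_nonneg_left (hC _) (norm_nonneg _)
  have hint : Integrable (fun w => g w • -fderiv ℝ θ (w - x)) :=
    (hg.norm.mul_const C).mono' (hmeas x) (Filter.Eventually.of_forall fun w => hbound w x)
  refine ⟨∫ w, g w • -fderiv ℝ θ (w - x), ?_, fun v => ?_⟩
  · refine hasFDerivAt_integral_of_dominated_of_fderiv_le (s := Set.univ)
      (F := fun x w => θ (w - x) * g w) (F' := fun x w => g w • -fderiv ℝ θ (w - x))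
      (bound := fun w => ‖g w‖ * C) Filter.univ_mem ?_ ?_ (hmeas x) ?_ (hg.norm.mul_const C) ?_
    · exact Filter.Eventually.of_forall fun y =>
        (hcont y).aestronglyMeasurable.mul hg.aestronglyMeasurable
    · exact hg.bdd_mul (hcont x).aestronglyMeasurable
        (Filter.Eventually.of_forall fun w => hC₀ (w - x))
    · exact Filter.Eventually.of_forall fun w y _ => hbound w y
    · refine Filter.Eventually.of_forall fun w y _ => ?_
      have h1 : HasFDerivAt (fun y : ℂ => w - y) (-ContinuousLinearMap.id ℝ ℂ) y :=
        (hasFDerivAt_id y).const_sub w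
      have h2 := ((hθ.differentiable one_ne_zero (w - y)).hasFDerivAt.comp y h1).mul_const (g w)
      exact h2.congr_fderiv (by ext v; simp)
  · rw [ContinuousLinearMap.integral_apply hint, ← integral_neg]
    congr 1 with w
    simp [mul_comm]

/-- Cutting `g` off outside `K` changes none of the integrals for translations in `O`, so the
globally integrable case applies. -/
theorem exists_hasFDerivAt_integral_translate_of_integrableOn {θ g : ℂ → ℂ} (hθ : ContDiff ℝ 1 θ)
    (hθc : HasCompactSupport θ) {K O : Set ℂ} (hK : MeasurableSet K) (hg : IntegrableOn g K)
    (hO : IsOpen O) (hOK : ∀ x ∈ O, ∀ w, w - x ∈ tsupport θ → w ∈ K) {x : ℂ} (hx : x ∈ O) :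
    ∃ L : ℂ →L[ℝ] ℂ, HasFDerivAt (fun x => ∫ w, θ (w - x) * g w) L x ∧
      ∀ v, L v = -∫ w, fderiv ℝ θ (w - x) v * g w := by
  have hgi : Integrable (K.indicator g) := (integrable_indicator_iff hK).2 hg
  obtain ⟨L, hL, hLv⟩ := exists_hasFDerivAt_integral_translate hθ hθc hgi x
  refine ⟨L, hL.congr_of_eventuallyEq ?_, fun v => ?_⟩
  · filter_upwards [hO.mem_nhds hx] with y hy
    congr 1 with w
    by_cases hw : w - y ∈ tsupport θ
    · simp [hOK y hy w hw]
    · simp [image_eq_zero_of_notMem_tsupport hw]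
  · rw [hLv]
    congr 2 with w
    by_cases hw : w - x ∈ tsupport θ
    · simp [hOK x hx w hw]
    · have : fderiv ℝ θ (w - x) = 0 :=
        image_eq_zero_of_notMem_tsupport fun h => hw (tsupport_fderiv_subset ℝ h)
      simp [this]

theorem fderiv_translate (θ : ℂ → ℂ) (x w : ℂ) :
    fderiv ℝ (fun w => θ (w - x)) w = fderiv ℝ θ (w - x) :=
  fderiv_comp_sub x

/-! ### Directional monotonicity of the pieces -/

namespace IsMaximalPartition

variable {ι : Type*} {U : Set ℂ} {Φ : ℂ → ℂ} {A : ι → ℂ → ℂ} {M : ι → Set ℂ}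

/-- In a ball that meets only the pieces `k` and `j`, the indicator function of the piece `k`
has a nonnegative derivative in every direction `v` with `Re ((A k - A j) v) > 0`. -/
theorem integral_indicator_fderiv_nonpos (h : IsMaximalPartition U Φ A M) {k j : ι} (hkj : k ≠ j)
    (hΦ : LocallyIntegrableOn Φ U volume) (hpos : DbarNonneg U Φ)
    (hA : ∀ i, DifferentiableOn ℂ (A i) U) {B : Set ℂ} (hB : IsOpen B) (hBU : B ⊆ U)
    (hd : ∀ i, i ≠ k → i ≠ j → Disjoint B (M i)) {v : ℂ}
    (hv : ∀ z ∈ B, 0 < ((A k z - A j z) * v).re) {ψ : ℂ → ℝ} (hψ : ContDiff ℝ (⊤ : ℕ∞) ψ)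
    (hψc : HasCompactSupport ψ) (hψB : tsupport ψ ⊆ B) (hψ0 : ∀ z, 0 ≤ ψ z) :
    ∫ z, fderiv ℝ ψ z v * (M k).indicator 1 z ≤ 0 := by
  have hψ1 : ContDiff ℝ 1 ψ := hψ.of_le (by exact_mod_cast le_top)
  have hD : ∀ z ∈ B, A k z - A j z ≠ 0 := fun z hz h0 => by simpa [h0] using hv z hz
  -- The factor cancels the jump `A k - A j` and leaves `conj v`, for which `Re (conj v · ∂ψ/∂z̄)`
  -- is half the derivative of `ψ` along `v`. Its real part has the sign of `Re ((A k - A j) v)`.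
  set H : ℂ → ℂ := fun z => (starRingEnd ℂ) v / (A k z - A j z) with hHdef
  have hHd : DifferentiableOn ℂ H B := (differentiableOn_const _).div
    (((hA k).mono hBU).sub ((hA j).mono hBU)) hD
  have hHs : ContDiffOn ℝ (⊤ : ℕ∞) H B := by
    have : ContDiffOn ℂ (⊤ : ℕ∞) H B := hHd.contDiffOn hB
    exact this.restrict_scalars ℝ
  have hH0 : ∀ z ∈ B, 0 ≤ (H z).re := by
    intro z hz
    have h1 : (H z).re = ((A k z - A j z) * v).re / Complex.normSq (A k z - A j z) := by
      simp only [hHdef, Complex.div_re, Complex.mul_re, Complex.conj_re, Complex.conj_im]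
      ring
    rw [h1]
    exact div_nonneg (hv z hz).le (Complex.normSq_nonneg _)
  have key := hpos.re_mul_nonneg hΦ hB hBU hHs hH0 hψ hψc hψB hψ0
  have hθ : ContDiff ℝ 1 (fun z => H z * ψ z) := by
    rw [contDiff_iff_contDiffAt]
    intro z
    by_cases hz : z ∈ B
    · exact ((hHs.contDiffAt (hB.mem_nhds hz)).of_le (by exact_mod_cast le_top)).mul
        (contDiff_ofReal_comp hψ1).contDiffAt
    · have : (fun z => H z * ψ z) =ᶠ[nhds z] fun _ => 0 := by
        filter_upwards [(isClosed_tsupport ψ).isOpen_compl.mem_nhds fun h => hz (hψB h)] with w hw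
        simp [image_eq_zero_of_notMem_tsupport hw]
      exact contDiffAt_const.congr_of_eventuallyEq this
  have hψcs := hasCompactSupport_ofReal_comp hψc
  have hθc : HasCompactSupport (fun z => H z * ψ z) := hψcs.mul_left
  have hθB : tsupport (fun z => H z * ψ z) ⊆ B :=
    tsupport_mul_subset_right.trans ((tsupport_ofReal_comp_subset ψ).trans hψB)
  have hdb : ∀ z ∈ B, dbar (fun z => H z * ψ z) z = H z * dbar (fun z => (ψ z : ℂ)) z := by
    intro z hz
    have hHz := (hHd.differentiableAt (hB.mem_nhds hz)).hasDerivAt.hasFDerivAt.restrictScalars ℝ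
    have hψz := ((contDiff_ofReal_comp hψ1).differentiable one_ne_zero z).hasFDerivAt
    unfold dbar
    rw [(hHz.fun_mul hψz).fderiv]
    simp only [add_apply, smul_apply, smul_eq_mul, ContinuousLinearMap.coe_restrictScalars',
      ContinuousLinearMap.toSpanSingleton_apply]
    linear_combination (1 / 2 : ℂ) * (ψ z * deriv H z) * Complex.I_mul_I
  -- Since `A j` is holomorphic, it can be subtracted from `Φ` at no cost; the difference is
  -- supported on `M k` within `B`.
  have hA0 := integral_dbar_mul_holomorphic hB hθ hθc hθB ((hA j).mono hBU)
  have hint := integrable_dbar_mul hθ hθc hθB (hΦ.mono_set hBU)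
  have hintA := integrable_dbar_mul hθ hθc hθB
    (((hA j).mono hBU).continuousOn.locallyIntegrableOn hB.measurableSet)
  have hsub : ∫ z, dbar (fun z => H z * ψ z) z * Φ z =
      ∫ z, (starRingEnd ℂ) v * dbar (fun z => (ψ z : ℂ)) z * (M k).indicator 1 z := by
    rw [← sub_zero (∫ z, dbar (fun z => H z * ψ z) z * Φ z), ← hA0, ← integral_sub hint hintA]
    refine integral_congr_ae ?_
    filter_upwards [h.ae_cover, h.ae_eq k, h.ae_eq j] with z hc hk hj
    by_cases hz : z ∈ B
    · rw [hdb z hz, ← mul_sub]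
      obtain ⟨i, hi⟩ := hc (hBU hz)
      by_cases hik : i = k
      · subst hik
        rw [hk hi, Set.indicator_of_mem hi]
        have := hD z hz
        simp only [hHdef, Pi.one_apply]
        field_simp
      · by_cases hij : i = j
        · subst hij
          rw [hj hi, Set.indicator_of_notMem fun hk =>
            Set.disjoint_left.1 (h.disjoint i k hik) hi hk]
          simp
        · exact absurd hi (Set.disjoint_left.1 (hd i hik hij) hz)
    · have h1 : fderiv ℝ (fun z => H z * ψ z) z = 0 :=
        image_eq_zero_of_notMem_tsupport fun h => hz (hθB (tsupport_fderiv_subset ℝ h))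
      have h2 : fderiv ℝ (fun z => (ψ z : ℂ)) z = 0 :=
        image_eq_zero_of_notMem_tsupport fun h =>
          hz (hψB (tsupport_ofReal_comp_subset ψ (tsupport_fderiv_subset ℝ h)))
      simp [dbar, h1, h2]
  have hre : (∫ z, (starRingEnd ℂ) v * dbar (fun z => (ψ z : ℂ)) z * (M k).indicator 1 z).re =
      (1 / 2) * ∫ z, fderiv ℝ ψ z v * (M k).indicator 1 z := by
    have hpt : ∀ z, ((starRingEnd ℂ) v * dbar (fun z => (ψ z : ℂ)) z *
        (M k).indicator 1 z).re = (1 / 2) * (fderiv ℝ ψ z v * (M k).indicator 1 z) := by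
      intro z
      have hv' : v = v.re • (1 : ℂ) + v.im • Complex.I := by
        simp [Complex.re_add_im]
      have e : fderiv ℝ ψ z v = v.re * fderiv ℝ ψ z 1 + v.im * fderiv ℝ ψ z Complex.I := by
        conv_lhs => rw [hv', map_add, map_smul, map_smul]
        simp
      have hdz := hψ1.differentiable one_ne_zero z
      rw [e, dbar, fderiv_ofReal_comp hdz, fderiv_ofReal_comp hdz]
      by_cases hz : z ∈ M k
      · simp [hz, Complex.mul_re, Complex.mul_im]
        ring
      · simp [hz]
    rw [← integral_const_mul]
    simp_rw [← hpt]
    have := integrable_dbar_mul (U := Set.univ) (g := (M k).indicator 1)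
      (contDiff_ofReal_comp hψ1) hψcs (Set.subset_univ _)
      (((locallyIntegrable_const (1 : ℂ)).indicator (h.isOpen k).measurableSet).locallyIntegrableOn
        _)
    refine (integral_re (𝕜 := ℂ) ?_).symm
    simpa [mul_assoc] using this.const_mul ((starRingEnd ℂ) v)
  rw [dbarPairing, hsub, Complex.neg_re, hre] at key
  linarith

end IsMaximalPartition

/-- Projection along `v` onto a line is Lipschitz, so the image of `E` is Lebesgue null and cannot
fill an interval; any value it misses gives a line parallel to `v` that avoids `E`. -/
theorem exists_line_avoiding {E : Set ℂ} (hE : Measure.hausdorffMeasure 1 E = 0) {v : ℂ}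
    (hv : v ≠ 0) (y : ℂ) {δ : ℝ} (hδ : 0 < δ) :
    ∃ y' ∈ Metric.ball y δ, ∀ σ : ℝ, y' + σ * v ∉ E := by
  let π : ℂ →L[ℝ] ℝ :=
    Complex.imCLM ∘L ((ContinuousLinearMap.mul ℝ ℂ).flip ((starRingEnd ℂ) v))
  have hπ : ∀ z, π z = (z * (starRingEnd ℂ) v).im := fun z => rfl
  have hnull : volume (π '' E) = 0 := by
    have h := π.lipschitz.hausdorffMeasure_image_le (d := 1) zero_le_one E
    rw [hE, mul_zero, nonpos_iff_eq_zero] at h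
    rwa [← hausdorffMeasure_real]
  have hvpos : 0 < ‖v‖ := norm_pos_iff.2 hv
  obtain ⟨a, ha, haE⟩ : ∃ a ∈ Set.Ioo (π y) (π y + δ * ‖v‖), a ∉ π '' E := by
    by_contra! hcon
    have := measure_mono_null hcon hnull
    rw [Real.volume_Ioo] at this
    simp only [add_sub_cancel_left, ENNReal.ofReal_eq_zero] at this
    exact absurd this (not_le.2 (mul_pos hδ hvpos))
  have hvv : v * (starRingEnd ℂ) v = ((‖v‖ ^ 2 : ℝ) : ℂ) := by
    rw [Complex.mul_conj, Complex.normSq_eq_norm_sq]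
  -- Moving `y` by `τ I v`, perpendicular to `v`, raises `π` by `τ ‖v‖ ^ 2`, so this `τ` brings it
  -- to the missed value `a`.
  set τ : ℝ := (a - π y) / ‖v‖ ^ 2 with hτ
  have hτ0 : 0 < τ := div_pos (by linarith [ha.1]) (by positivity)
  refine ⟨y + τ * (Complex.I * v), ?_, fun σ hσ => haE ⟨_, hσ, ?_⟩⟩
  · rw [Metric.mem_ball, dist_eq_norm, add_sub_cancel_left, norm_mul, norm_mul, Complex.norm_I,
      one_mul, Complex.norm_real, Real.norm_of_nonneg hτ0.le, hτ, div_mul_eq_mul_div,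
      div_lt_iff₀ (by positivity)]
    nlinarith [ha.2]
  · have e : (y + τ * (Complex.I * v) + σ * v) * (starRingEnd ℂ) v =
        y * (starRingEnd ℂ) v + (τ * ‖v‖ ^ 2 : ℝ) * Complex.I + (σ * ‖v‖ ^ 2 : ℝ) := by
      push_cast at hvv ⊢
      linear_combination (τ * Complex.I + σ) * hvv
    rw [hπ, e, hτ, div_mul_cancel₀ _ (by positivity), Complex.add_im, Complex.add_im,
      Complex.im_ofReal_mul, Complex.I_im, Complex.ofReal_im, ← hπ]
    ring

namespace IsMaximalPartition

variable {ι : Type*} {U : Set ℂ} {Φ : ℂ → ℂ} {A : ι → ℂ → ℂ} {M : ι → Set ℂ}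

/-- The mass of `1_{M k}` against a bump is nondecreasing as the bump slides along `v`. It starts at
`x` with the full mass of the bump, so it ends with full mass at `x + t v`; thus `M k` fills almost
all of a ball there, and maximality includes that ball. -/
theorem add_mul_mem_of_two_pieces (h : IsMaximalPartition U Φ A M) {k j : ι} (hkj : k ≠ j)
    (hΦ : LocallyIntegrableOn Φ U volume) (hpos : DbarNonneg U Φ)
    (hA : ∀ i, DifferentiableOn ℂ (A i) U) {B : Set ℂ} (hB : IsOpen B) (hBc : Convex ℝ B)
    (hBU : B ⊆ U) (hd : ∀ i, i ≠ k → i ≠ j → Disjoint B (M i)) {v : ℂ}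
    (hv : ∀ z ∈ B, 0 < ((A k z - A j z) * v).re) {x : ℂ} (hx : x ∈ M k) (hxB : x ∈ B) {t : ℝ}
    (ht : 0 ≤ t) (hxt : x + t * v ∈ B) : x + t * v ∈ M k := by
  obtain ⟨ε, hε, hball⟩ := Metric.isOpen_iff.1
    (((h.isOpen k).inter hB).inter
      (hB.preimage (by fun_prop : Continuous fun w : ℂ => w + t * v)))
    x ⟨⟨hx, hxB⟩, hxt⟩
  have hballM : Metric.ball x ε ⊆ M k := fun w hw => (hball hw).1.1
  have hballB : Metric.ball x ε ⊆ B := fun w hw => (hball hw).1.2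
  have hballt : ∀ w ∈ Metric.ball x ε, w + t * v ∈ B := fun w hw => (hball hw).2
  let ψ : ContDiffBump x := ⟨ε / 4, ε / 2, by positivity, by linarith⟩
  have hψd : ContDiff ℝ (⊤ : ℕ∞) (ψ : ℂ → ℝ) := ψ.contDiff
  have hψ1 : ContDiff ℝ 1 (ψ : ℂ → ℝ) := ψ.contDiff
  have hψc : HasCompactSupport (ψ : ℂ → ℝ) := ψ.hasCompactSupport
  have hψs : tsupport (ψ : ℂ → ℝ) = Metric.closedBall x (ε / 2) := ψ.tsupport_eq
  have hψball : tsupport (ψ : ℂ → ℝ) ⊆ Metric.ball x ε := by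
    rw [hψs]; exact Metric.closedBall_subset_ball (by linarith)
  have hmeas := (h.isOpen k).measurableSet
  set θ : ℂ → ℂ := fun w => (ψ w : ℂ)
  set F : ℂ → ℂ := fun y => ∫ w, θ (w - y) * (M k).indicator 1 w with hF
  have hFre : ∀ y, F y = ((∫ w, ψ (w - y) * (M k).indicator 1 w : ℝ) : ℂ) := by
    intro y
    simp only [hF]
    rw [← integral_complex_ofReal]
    congr 1 with w
    by_cases hw : w ∈ M k <;> simp [hw, θ]
  have hderiv : ∀ σ ∈ Set.Icc 0 t, ∃ c : ℝ, 0 ≤ c ∧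
      HasDerivAt (fun σ : ℝ => ∫ w, ψ (w - σ * v) * (M k).indicator 1 w) c σ := by
    intro σ hσ
    obtain ⟨L, hL, hLv⟩ := exists_hasFDerivAt_integral_translate_of_integrableOn
      (g := (M k).indicator 1) (contDiff_ofReal_comp hψ1) (hasCompactSupport_ofReal_comp hψc)
      -- `O` is a neighbourhood of the translation `σ v`, and `K` contains the supports of all bumps
      -- translated by elements of `O`.
      (K := Metric.closedBall x (ε / 2 + (‖σ * v‖ + 1))) (O := Metric.ball 0 (‖σ * v‖ + 1))
      Metric.isClosed_closedBall.measurableSet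
      ((integrableOn_const (by exact measure_closedBall_lt_top.ne)).indicator hmeas)
      Metric.isOpen_ball
      (fun y hy w hw => by
        have h1 : w - y ∈ Metric.closedBall x (ε / 2) := hψs ▸ tsupport_ofReal_comp_subset _ hw
        rw [Metric.mem_closedBall, dist_eq_norm] at h1 ⊢
        rw [Metric.mem_ball, dist_zero_right] at hy
        calc ‖w - x‖ = ‖(w - y - x) + y‖ := by congr 1; ring
          _ ≤ ‖w - y - x‖ + ‖y‖ := norm_add_le _ _
          _ ≤ _ := by linarith)
      (x := σ * v) (by simp)
    have hlin : HasDerivAt (fun σ : ℝ => (σ : ℂ) * v) v σ := by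
      simpa using (Complex.ofRealCLM.hasDerivAt (x := σ)).mul_const v
    have hcomp := hL.comp_hasDerivAt σ hlin
    set ψσ : ℂ → ℝ := fun w => ψ (w - σ * v)
    have hψσ : ContDiff ℝ (⊤ : ℕ∞) ψσ := hψd.comp (contDiff_id.sub contDiff_const)
    have hψσs : tsupport ψσ = {w | w - σ * v ∈ tsupport (ψ : ℂ → ℝ)} :=
      tsupport_comp_eq_preimage (ψ : ℂ → ℝ) (Homeomorph.subRight ((σ : ℂ) * v))
    have hfd : ∀ w, fderiv ℝ ψσ w = fderiv ℝ ψ (w - σ * v) := fun w => fderiv_comp_sub _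
    have hnonpos := h.integral_indicator_fderiv_nonpos hkj hΦ hpos hA hB hBU hd hv hψσ
      (hasCompactSupport_comp_sub_right hψc _) (by
        rw [hψσs]
        intro w hw
        have hw' := hψball hw
        rcases ht.eq_or_lt with rfl | ht'
        · have : σ = 0 := le_antisymm hσ.2 hσ.1
          subst this
          simpa using hballB hw'
        have := hBc (hballB hw') (hballt _ hw') (a := 1 - σ / t) (b := σ / t)
          (by rw [sub_nonneg, div_le_one ht']; exact hσ.2) (div_nonneg hσ.1 ht) (by ring)
        convert this using 1
        simp only [Complex.real_smul]
        push_cast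
        have : (t : ℂ) ≠ 0 := by exact_mod_cast ht'.ne'
        field_simp
        ring) (fun w => ψ.nonneg)
    refine ⟨-∫ w, fderiv ℝ ψσ w v * (M k).indicator 1 w, by linarith, ?_⟩
    have hLval : L v = ((-∫ w, fderiv ℝ ψσ w v * (M k).indicator 1 w : ℝ) : ℂ) := by
      rw [hLv, Complex.ofReal_neg, ← integral_complex_ofReal]
      congr 2 with w
      rw [fderiv_ofReal_comp (hψ1.differentiable one_ne_zero _), hfd]
      by_cases hw : w ∈ M k <;> simp [hw]
    rw [hLval] at hcomp
    have hre := (Complex.reCLM.hasFDerivAt).comp_hasDerivAt σ hcomp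
    refine (hre.congr_of_eventuallyEq (Filter.Eventually.of_forall fun s => ?_))
    change _ = (F (s * v)).re
    rw [hFre, Complex.ofReal_re]
  have hmono : (∫ w, ψ (w - (0 : ℝ) * v) * (M k).indicator 1 w) ≤
      ∫ w, ψ (w - t * v) * (M k).indicator 1 w := by
    refine monotoneOn_of_deriv_nonneg (convex_Icc 0 t)
      (f := fun σ : ℝ => ∫ w, ψ (w - σ * v) * (M k).indicator 1 w)
      (fun σ hσ => ?_) (fun σ hσ => ?_) (fun σ hσ => ?_) ⟨le_rfl, ht⟩ ⟨ht, le_rfl⟩ ht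
    · obtain ⟨c, _, hc⟩ := hderiv σ hσ
      exact hc.continuousAt.continuousWithinAt
    · obtain ⟨c, _, hc⟩ := hderiv σ (interior_subset hσ)
      exact hc.differentiableAt.differentiableWithinAt
    · obtain ⟨c, hc0, hc⟩ := hderiv σ (interior_subset hσ)
      rw [hc.deriv]
      exact hc0
  -- The initial bump lies inside `M k`, so its weighted mass is its total mass, which translation
  -- preserves.
  have hzero : (∫ w, ψ (w - (0 : ℝ) * v) * (M k).indicator 1 w) = ∫ w, ψ (w - t * v) := by
    rw [integral_sub_right_eq_self (fun w => ψ w) ((t : ℂ) * v)]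
    congr 1 with w
    by_cases hw : w ∈ M k
    · simp [hw]
    · have : ψ w = 0 := image_eq_zero_of_notMem_tsupport fun h => hw (hballM (hψball h))
      simp [this]
  have hψt : Integrable fun w => ψ (w - t * v) :=
    (hψ1.continuous.comp (continuous_id.sub continuous_const)).integrable_of_hasCompactSupport
      (hasCompactSupport_comp_sub_right hψc _)
  have hψtM : Integrable fun w => ψ (w - t * v) * (M k).indicator 1 w := by
    refine (hψt.indicator hmeas).congr (Filter.Eventually.of_forall fun w => ?_)
    by_cases hw : w ∈ M k <;> simp [hw]
  have hdiff0 : ∀ w, 0 ≤ ψ (w - t * v) - ψ (w - t * v) * (M k).indicator 1 w := by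
    intro w
    by_cases hw : w ∈ M k
    · simp [hw]
    · simpa [hw] using ψ.nonneg
  have hint0 : ∫ w, (ψ (w - t * v) - ψ (w - t * v) * (M k).indicator 1 w) = 0 := by
    refine le_antisymm ?_ (integral_nonneg hdiff0)
    rw [integral_sub hψt hψtM]
    linarith
  have hae := (integral_eq_zero_iff_of_nonneg hdiff0 (hψt.sub hψtM)).1 hint0
  have hsub : Metric.ball (x + t * v) (ε / 2) ⊆ M k := by
    refine h.maximal k _ Metric.isOpen_ball (fun w hw => hBU ?_) ?_
    · have : w - t * v ∈ Metric.ball x ε := by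
        rw [Metric.mem_ball, dist_eq_norm] at hw ⊢
        rw [show w - t * v - x = w - (x + t * v) by ring]
        linarith
      simpa using hballt _ this
    · filter_upwards [hae, h.ae_eq k] with w hw hk hwb
      by_cases hwM : w ∈ M k
      · exact hk hwM
      · have : 0 < ψ (w - t * v) := by
          refine ψ.pos_of_mem_ball ?_
          rw [Metric.mem_ball, dist_eq_norm] at hwb ⊢
          rwa [show w - t * v - x = w - (x + t * v) by ring]
        simp [hwM] at hw
        exact absurd hw this.ne'
  exact hsub (Metric.mem_ball_self (by positivity))

variable [Finite ι]

/-- Away from triple boundary points, a boundary point of `M k` is adherent to exactly one other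
piece, so a small ball about it is a two-piece situation. With no other adherent piece, maximality
would put the point inside `M k`. -/
theorem exists_ball_add_mul_mem (h : IsMaximalPartition U Φ A M)
    (hΦ : LocallyIntegrableOn Φ U volume) (hpos : DbarNonneg U Φ)
    (hA : ∀ i, DifferentiableOn ℂ (A i) U) {N : Set ℂ} (hN : IsOpen N) (hNU : N ⊆ U) {k : ι}
    {v : ℂ} (hv : ∀ j, j ≠ k → Disjoint N (M j) ∨ ∀ z ∈ N, 0 < ((A k z - A j z) * v).re) {q : ℂ}
    (hq : q ∈ N) (hE : ∀ i j, i ≠ k → j ≠ k → i ≠ j →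
      q ∉ frontier (M k) ∩ frontier (M i) ∩ frontier (M j)) :
    ∃ s > 0, ∀ x ∈ M k ∩ Metric.ball q s, ∀ t : ℝ, 0 ≤ t → x + t * v ∈ Metric.ball q s →
      x + t * v ∈ M k := by
  classical
  by_cases hqk : q ∈ M k
  · obtain ⟨s, hs, hsub⟩ := Metric.isOpen_iff.1 (h.isOpen k) q hqk
    exact ⟨s, hs, fun x _ t _ hx => hsub hx⟩
  by_cases hcl : q ∈ closure (M k)
  swap
  · obtain ⟨s, hs, hsub⟩ := Metric.isOpen_iff.1 isClosed_closure.isOpen_compl q hcl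
    exact ⟨s, hs, fun x hx => absurd (subset_closure hx.1) (hsub hx.2)⟩
  have hfr : ∀ i, q ∈ closure (M i) → q ∈ frontier (M i) := by
    intro i hi
    rw [(h.isOpen i).frontier_eq]
    exact ⟨hi, fun hqi => hqk ((h.eq_of_mem_of_mem_closure hqi hcl) ▸ hqi)⟩
  set V := N ∩ ⋂ i, (if q ∈ closure (M i) then Set.univ else (closure (M i))ᶜ)
  have hV : IsOpen V := by
    refine hN.inter (isOpen_iInter_of_finite fun i => ?_)
    split_ifs
    · exact isOpen_univ
    · exact isClosed_closure.isOpen_compl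
  have hqV : q ∈ V := by
    refine ⟨hq, Set.mem_iInter.2 fun i => ?_⟩
    split_ifs with hi
    · trivial
    · exact hi
  obtain ⟨s, hs, hsub⟩ := Metric.isOpen_iff.1 hV q hqV
  have hdisj : ∀ i, q ∉ closure (M i) → Disjoint (Metric.ball q s) (M i) := by
    intro i hi
    rw [Set.disjoint_left]
    intro w hw hwi
    have := Set.mem_iInter.1 (hsub hw).2 i
    rw [if_neg hi] at this
    exact this (subset_closure hwi)
  have hsN : Metric.ball q s ⊆ N := fun w hw => (hsub hw).1
  by_cases hex : ∃ j, j ≠ k ∧ q ∈ closure (M j)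
  · obtain ⟨j, hjk, hj⟩ := hex
    have hvj : ∀ z ∈ N, 0 < ((A k z - A j z) * v).re := by
      refine (hv j hjk).resolve_left fun hd => ?_
      obtain ⟨w, hw, hw'⟩ := mem_closure_iff.1 hj N hN hq
      exact Set.disjoint_left.1 hd hw hw'
    refine ⟨s, hs, fun x hx t ht hxt => ?_⟩
    refine h.add_mul_mem_of_two_pieces hjk.symm hΦ hpos hA Metric.isOpen_ball
      (convex_ball q s) (hsN.trans hNU) (fun i hik hij => hdisj i fun hi => ?_)
      (fun z hz => hvj z (hsN hz)) hx.1 hx.2 ht hxt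
    exact hE j i hjk hik hij.symm ⟨⟨hfr k hcl, hfr j hj⟩, hfr i hi⟩
  · push Not at hex
    exact absurd (h.subset_of_forall_disjoint Metric.isOpen_ball (hsN.trans hNU)
      (fun j hj => hdisj j (hex j hj)) (Metric.mem_ball_self hs)) hqk

/-- At the first exit time from `M k`, the local statement at the exit point carries slightly
earlier points of the segment, still in `M k`, onto the exit point itself. -/
theorem add_mul_mem_of_avoiding (h : IsMaximalPartition U Φ A M)
    (hΦ : LocallyIntegrableOn Φ U volume) (hpos : DbarNonneg U Φ)
    (hA : ∀ i, DifferentiableOn ℂ (A i) U) {N : Set ℂ} (hN : IsOpen N) (hNU : N ⊆ U) {k : ι}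
    {v : ℂ} (hv : ∀ j, j ≠ k → Disjoint N (M j) ∨ ∀ z ∈ N, 0 < ((A k z - A j z) * v).re)
    {x : ℂ} (hx : x ∈ M k) {t : ℝ} (ht : 0 ≤ t)
    (hxN : ∀ σ ∈ Set.Icc (0 : ℝ) t, x + (σ : ℂ) * v ∈ N)
    (hE : ∀ σ ∈ Set.Icc (0 : ℝ) t, ∀ i j, i ≠ k → j ≠ k → i ≠ j →
      x + (σ : ℂ) * v ∉ frontier (M k) ∩ frontier (M i) ∩ frontier (M j)) :
    x + t * v ∈ M k := by
  by_contra hcon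
  have hcont : Continuous fun σ : ℝ => x + (σ : ℂ) * v := by fun_prop
  set T := Set.Icc 0 t ∩ (fun σ : ℝ => x + (σ : ℂ) * v) ⁻¹' (M k)ᶜ
  have hTc : IsClosed T := isClosed_Icc.inter ((h.isOpen k).isClosed_compl.preimage hcont)
  have hTne : T.Nonempty := ⟨t, ⟨ht, le_rfl⟩, hcon⟩
  have hTb : BddBelow T := ⟨0, fun σ hσ => hσ.1.1⟩
  set σ₀ := sInf T
  have hσ₀ : σ₀ ∈ T := hTc.csInf_mem hTne hTb
  have hpos0 : 0 < σ₀ := by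
    refine lt_of_le_of_ne hσ₀.1.1 fun h0 => hσ₀.2 ?_
    rw [← h0]
    simpa using hx
  obtain ⟨s, hs, hloc⟩ := h.exists_ball_add_mul_mem hΦ hpos hA hN hNU hv (hxN σ₀ hσ₀.1)
    (hE σ₀ hσ₀.1)
  have hnear : ∀ᶠ σ : ℝ in nhdsWithin σ₀ (Set.Iio σ₀),
      x + (σ : ℂ) * v ∈ Metric.ball (x + σ₀ * v) s :=
    mem_nhdsWithin_of_mem_nhds (hcont.continuousAt.preimage_mem_nhds (Metric.ball_mem_nhds _ hs))
  have hpos' : ∀ᶠ σ in nhdsWithin σ₀ (Set.Iio σ₀), 0 < σ :=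
    mem_nhdsWithin_of_mem_nhds (Ioi_mem_nhds hpos0)
  obtain ⟨σ, ⟨hσb, hσ0⟩, hσlt⟩ := ((hnear.and hpos').and self_mem_nhdsWithin).exists
  have hσlt' : σ < σ₀ := hσlt
  have hσM : x + (σ : ℂ) * v ∈ M k := by
    by_contra hσM
    exact absurd (csInf_le hTb ⟨⟨hσ0.le, hσlt'.le.trans hσ₀.1.2⟩, hσM⟩) (not_le.2 hσlt')
  refine hσ₀.2 ?_
  have := hloc _ ⟨hσM, hσb⟩ (σ₀ - σ) (by linarith)
  have e : x + (σ : ℂ) * v + ((σ₀ - σ : ℝ) : ℂ) * v = x + σ₀ * v := by push_cast; ring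
  rw [e] at this
  exact this (Metric.mem_ball_self hs)

/-- If another piece met a small ball about `x + t v`, it would do so on an open set; some line
parallel to `v` through that set avoids all triple points, and following it from `M k` ends in both
pieces at once. -/
theorem add_mul_mem (h : IsMaximalPartition U Φ A M)
    (hΦ : LocallyIntegrableOn Φ U volume) (hpos : DbarNonneg U Φ)
    (hA : ∀ i, DifferentiableOn ℂ (A i) U) {N : Set ℂ} (hN : IsOpen N) (hNc : Convex ℝ N)
    (hNU : N ⊆ U) (hE : ∀ i j k, i ≠ j → i ≠ k → j ≠ k → Measure.hausdorffMeasure 1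
      (U ∩ (frontier (M i) ∩ frontier (M j) ∩ frontier (M k))) = 0) {k : ι}
    {v : ℂ} (hv : ∀ j, j ≠ k → Disjoint N (M j) ∨ ∀ z ∈ N, 0 < ((A k z - A j z) * v).re)
    {x : ℂ} (hx : x ∈ M k) (hxN : x ∈ N) {t : ℝ} (ht : 0 ≤ t) (hxt : x + t * v ∈ N) :
    x + t * v ∈ M k := by
  rcases eq_or_ne v 0 with rfl | hv0
  · simpa using hx
  obtain ⟨δ, hδ, hball⟩ := Metric.isOpen_iff.1
    (hN.inter (((h.isOpen k).inter hN).preimage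
      (by fun_prop : Continuous fun w : ℂ => w - t * v)))
    (x + t * v) (show x + t * v ∈ N ∩ (fun w => w - t * v) ⁻¹' (M k ∩ N) from
      ⟨hxt, by simpa using ⟨hx, hxN⟩⟩)
  refine h.subset_of_forall_disjoint (k := k) Metric.isOpen_ball
    (fun w hw => hNU (hball hw).1) (fun i hi => ?_) (Metric.mem_ball_self hδ)
  rw [Set.disjoint_left]
  intro y hy hyi
  obtain ⟨δ', hδ', hball'⟩ := Metric.isOpen_iff.1 (Metric.isOpen_ball.inter (h.isOpen i)) y
    ⟨hy, hyi⟩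
  set E := ⋃ (i) (j), ⋃ (_ : i ≠ k ∧ j ≠ k ∧ i ≠ j),
    U ∩ (frontier (M k) ∩ frontier (M i) ∩ frontier (M j))
  have hE0 : Measure.hausdorffMeasure 1 E = 0 := by
    have := Finite.to_countable (α := ι)
    refine measure_iUnion_null fun i => measure_iUnion_null fun j => measure_iUnion_null fun hij =>
      hE k i j hij.1.symm hij.2.1.symm hij.2.2
  obtain ⟨y', hy', havoid⟩ := exists_line_avoiding hE0 hv0 y hδ'
  have hy'i := (hball' hy').2
  have hy'b := hball (hball' hy').1
  have hline : ∀ σ ∈ Set.Icc (0 : ℝ) t, y' - t * v + (σ : ℂ) * v ∈ N := by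
    intro σ hσ
    rcases ht.eq_or_lt with rfl | ht'
    · have : σ = 0 := le_antisymm hσ.2 hσ.1
      subst this
      simpa using hy'b.1
    have := hNc hy'b.2.2 hy'b.1 (a := 1 - σ / t) (b := σ / t)
      (by rw [sub_nonneg, div_le_one ht']; exact hσ.2) (div_nonneg hσ.1 ht) (by ring)
    convert this using 1
    simp only [Complex.real_smul]
    push_cast
    have : (t : ℂ) ≠ 0 := by exact_mod_cast ht'.ne'
    field_simp
    ring
  have hmem := h.add_mul_mem_of_avoiding hΦ hpos hA hN hNU hv (x := y' - t * v) hy'b.2.1 ht hline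
    (fun σ hσ i j hik hjk hij hmem => havoid (σ - t) (by
      have e : y' + ((σ - t : ℝ) : ℂ) * v = y' - t * v + σ * v := by push_cast; ring
      rw [e]
      exact Set.mem_iUnion₂.2 ⟨i, j, Set.mem_iUnion.2 ⟨⟨hik, hjk, hij⟩, hNU (hline σ hσ), hmem⟩⟩))
  rw [sub_add_cancel] at hmem
  exact Set.disjoint_left.1 (h.disjoint i k hi) hy'i hmem

end IsMaximalPartition

/-! ### Mollification and the primitive of `Re (Φ dz)` -/

/-- The properties of a mollifier supported in the closed ball of radius `ε`. -/
structure IsMollifier (ρ : ℂ → ℝ) (ε : ℝ) : Prop where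
  contDiff : ContDiff ℝ (⊤ : ℕ∞) ρ
  tsupport_subset : tsupport ρ ⊆ Metric.closedBall 0 ε
  nonneg : ∀ w, 0 ≤ ρ w
  integral_eq_one : ∫ w, ρ w = 1

theorem exists_isMollifier {ε : ℝ} (hε : 0 < ε) : ∃ ρ, IsMollifier ρ ε := by
  let φ : ContDiffBump (0 : ℂ) := ⟨ε / 2, ε, by positivity, by linarith⟩
  exact ⟨φ.normed volume, φ.contDiff_normed, φ.tsupport_normed_eq.subset, φ.nonneg_normed,
    φ.integral_normed⟩

/-- The regularization of `g` by the mollifier `ρ`. -/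
noncomputable def mollify (ρ : ℂ → ℝ) (g : ℂ → ℂ) (x : ℂ) : ℂ :=
  ∫ w, (ρ (w - x) : ℂ) * g w

namespace IsMollifier

variable {ρ : ℂ → ℝ} {ε : ℝ} {U : Set ℂ} {g : ℂ → ℂ} {x : ℂ}

theorem contDiff_one (h : IsMollifier ρ ε) : ContDiff ℝ 1 ρ :=
  h.contDiff.of_le (by exact_mod_cast le_top)

theorem hasCompactSupport (h : IsMollifier ρ ε) : HasCompactSupport ρ :=
  HasCompactSupport.of_support_subset_isCompact (isCompact_closedBall (0 : ℂ) ε)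
    ((subset_tsupport ρ).trans h.tsupport_subset)

theorem translate_contDiff (h : IsMollifier ρ ε) (x : ℂ) :
    ContDiff ℝ (⊤ : ℕ∞) fun w => ρ (w - x) :=
  h.contDiff.comp (contDiff_id.sub contDiff_const)

theorem translate_tsupport_subset (h : IsMollifier ρ ε) (x : ℂ) :
    tsupport (fun w => ρ (w - x)) ⊆ Metric.closedBall x ε := by
  intro w hw
  have h1 : w - x ∈ tsupport ρ := by
    rwa [show (fun w => ρ (w - x)) = ρ ∘ Homeomorph.subRight x from rfl,
      tsupport_comp_eq_preimage] at hw
  simpa [dist_eq_norm] using h.tsupport_subset h1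

theorem eq_zero_of_notMem (h : IsMollifier ρ ε) {w : ℂ} (hw : w ∉ Metric.closedBall x ε) :
    ρ (w - x) = 0 :=
  image_eq_zero_of_notMem_tsupport (f := fun w => ρ (w - x))
    fun h' => hw (h.translate_tsupport_subset x h')

theorem translate_hasCompactSupport (h : IsMollifier ρ ε) (x : ℂ) :
    HasCompactSupport fun w => ρ (w - x) :=
  hasCompactSupport_comp_sub_right h.hasCompactSupport x

theorem integrable_mul (h : IsMollifier ρ ε) (hxU : Metric.closedBall x ε ⊆ U)
    (hg : LocallyIntegrableOn g U volume) : Integrable fun w => (ρ (w - x) : ℂ) * g w :=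
  integrable_mul_of_tsupport_subset (contDiff_ofReal_comp (h.translate_contDiff x)).continuous
    (hasCompactSupport_ofReal_comp (h.translate_hasCompactSupport x))
    ((tsupport_ofReal_comp_subset _).trans ((h.translate_tsupport_subset x).trans hxU)) hg

theorem integrable_translate (h : IsMollifier ρ ε) (x : ℂ) : Integrable fun w => ρ (w - x) :=
  (h.translate_contDiff x).continuous.integrable_of_hasCompactSupport
    (h.translate_hasCompactSupport x)

theorem integral_translate (h : IsMollifier ρ ε) (x : ℂ) : ∫ w, ρ (w - x) = 1 := by
  rw [integral_sub_right_eq_self, h.integral_eq_one]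

theorem norm_mollify_le (h : IsMollifier ρ ε) {C : ℝ}
    (hC : ∀ᵐ w, w ∈ Metric.closedBall x ε → ‖g w‖ ≤ C) : ‖mollify ρ g x‖ ≤ C := by
  have hle : ‖mollify ρ g x‖ ≤ ∫ w, ρ (w - x) * C := by
    refine norm_integral_le_of_norm_le ((h.integrable_translate x).mul_const C) ?_
    filter_upwards [hC] with w hw
    rw [norm_mul, Complex.norm_real, Real.norm_of_nonneg (h.nonneg _)]
    by_cases hwx : w ∈ Metric.closedBall x ε
    · exact mul_le_mul_of_nonneg_left (hw hwx) (h.nonneg _)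
    · simp [h.eq_zero_of_notMem hwx]
  rwa [integral_mul_const, h.integral_translate, one_mul] at hle

theorem mollify_sub (h : IsMollifier ρ ε) (hxU : Metric.closedBall x ε ⊆ U) {g₁ g₂ : ℂ → ℂ}
    (h₁ : LocallyIntegrableOn g₁ U volume) (h₂ : LocallyIntegrableOn g₂ U volume) :
    mollify ρ (fun w => g₁ w - g₂ w) x = mollify ρ g₁ x - mollify ρ g₂ x := by
  unfold mollify
  rw [← integral_sub (h.integrable_mul hxU h₁) (h.integrable_mul hxU h₂)]
  simp_rw [mul_sub]

theorem mollify_const (h : IsMollifier ρ ε) (c : ℂ) : mollify ρ (fun _ => c) x = c := by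
  unfold mollify
  rw [integral_mul_const, integral_complex_ofReal, h.integral_translate]
  simp

theorem mollify_mul_re_nonpos (h : IsMollifier ρ ε) (hxU : Metric.closedBall x ε ⊆ U)
    (hg : LocallyIntegrableOn g U volume) {v : ℂ}
    (hv : ∀ᵐ w, w ∈ Metric.closedBall x ε → (g w * v).re ≤ 0) : (mollify ρ g x * v).re ≤ 0 := by
  unfold mollify
  rw [← integral_mul_const]
  have hint := (h.integrable_mul hxU hg).mul_const v
  have := integral_re (𝕜 := ℂ) hint
  change _ = (∫ w, (ρ (w - x) : ℂ) * g w * v).re at this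
  rw [← this]
  refine integral_nonpos_of_ae ?_
  filter_upwards [hv] with w hw
  change ((ρ (w - x) : ℂ) * g w * v).re ≤ 0
  rw [mul_assoc, Complex.re_ofReal_mul]
  by_cases hwx : w ∈ Metric.closedBall x ε
  · exact mul_nonpos_of_nonneg_of_nonpos (h.nonneg _) (hw hwx)
  · simp [h.eq_zero_of_notMem hwx]

theorem mollify_eq_zero (h : IsMollifier ρ ε)
    (hg : ∀ᵐ w, w ∈ Metric.closedBall x ε → g w = 0) : mollify ρ g x = 0 := by
  refine integral_eq_zero_of_ae ?_
  filter_upwards [hg] with w hw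
  by_cases hwx : w ∈ Metric.closedBall x ε
  · simp [hw hwx]
  · simp [h.eq_zero_of_notMem hwx]

theorem exists_hasFDerivAt_mollify (h : IsMollifier ρ ε) {p : ℂ} {R R₁ : ℝ}
    (hR : R₁ + ε ≤ R) (hRU : Metric.closedBall p R ⊆ U) (hg : LocallyIntegrableOn g U volume)
    (hx : x ∈ Metric.ball p R₁) :
    ∃ L : ℂ →L[ℝ] ℂ, HasFDerivAt (mollify ρ g) L x ∧
      ∀ v, L v = -∫ w, fderiv ℝ (fun w => (ρ (w - x) : ℂ)) w v * g w := by
  obtain ⟨L, hL, hLv⟩ := exists_hasFDerivAt_integral_translate_of_integrableOn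
    (contDiff_ofReal_comp h.contDiff_one) (hasCompactSupport_ofReal_comp h.hasCompactSupport)
    (K := Metric.closedBall p R) (O := Metric.ball p R₁)
    Metric.isClosed_closedBall.measurableSet
    (hg.integrableOn_compact_subset hRU (isCompact_closedBall p R)) Metric.isOpen_ball
    (fun y hy w hw => by
      have h1 := h.tsupport_subset (tsupport_ofReal_comp_subset _ hw)
      rw [mem_closedBall_zero_iff] at h1
      rw [Metric.mem_closedBall]
      rw [Metric.mem_ball] at hy
      have h2 : dist w y ≤ ε := by rwa [dist_eq_norm]
      linarith [dist_triangle w y p]) hx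
  refine ⟨L, hL, fun v => ?_⟩
  rw [hLv]
  simp_rw [← fderiv_translate (fun w => (ρ w : ℂ)) x]

theorem closedBall_subset {p : ℂ} {R R₁ : ℝ} (hR : R₁ + ε ≤ R) (hx : x ∈ Metric.ball p R₁) :
    Metric.closedBall x ε ⊆ Metric.closedBall p R := by
  refine Metric.closedBall_subset_closedBall' ?_
  rw [Metric.mem_ball] at hx
  linarith

/-- Regularization commutes with holomorphic differentiation. -/
theorem hasFDerivAt_mollify_primitive (h : IsMollifier ρ ε) (hU : IsOpen U) {p : ℂ} {R R₁ : ℝ}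
    (hR : R₁ + ε ≤ R) (hRU : Metric.closedBall p R ⊆ U) {g' : ℂ → ℂ}
    (hg : ∀ z ∈ U, HasDerivAt g (g' z) z) (hg' : ContinuousOn g' U)
    (hx : x ∈ Metric.ball p R₁) :
    HasFDerivAt (mollify ρ g) (ContinuousLinearMap.mul ℝ ℂ (mollify ρ g' x)) x := by
  have hgc : ContinuousOn g U := fun z hz => (hg z hz).continuousAt.continuousWithinAt
  obtain ⟨L, hL, hLv⟩ := h.exists_hasFDerivAt_mollify hR hRU
    (hgc.locallyIntegrableOn hU.measurableSet) hx
  refine hL.congr_fderiv (ContinuousLinearMap.ext fun v => ?_)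
  rw [hLv, integral_fderiv_apply_mul_holomorphic hU
    (contDiff_ofReal_comp ((h.translate_contDiff x).of_le (by exact_mod_cast le_top)))
    (hasCompactSupport_ofReal_comp (h.translate_hasCompactSupport x))
    ((tsupport_ofReal_comp_subset _).trans ((h.translate_tsupport_subset x).trans
      ((closedBall_subset hR hx).trans hRU))) hg hg' v, neg_neg]
  simp_rw [← mul_assoc]
  rw [integral_mul_const]
  rfl

/-- If `∂Φ/∂z̄` is real, then the real `1`-form `Re (Φ dz)` has a primitive after
regularization. -/
theorem exists_primitive (h : IsMollifier ρ ε) {p : ℂ} {R R₁ : ℝ}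
    (hR : R₁ + ε ≤ R) (hRU : Metric.closedBall p R ⊆ U) {Φ : ℂ → ℂ}
    (hΦ : LocallyIntegrableOn Φ U volume) (hpos : DbarNonneg U Φ) :
    ∃ Ψ : ℂ → ℝ, ∀ x ∈ Metric.ball p R₁, HasFDerivAt Ψ
      (Complex.reCLM ∘L ContinuousLinearMap.mul ℝ ℂ (mollify ρ Φ x)) x := by
  let T : ℂ →L[ℝ] ℂ →L[ℝ] ℝ :=
    (ContinuousLinearMap.compL ℝ ℂ ℂ ℝ Complex.reCLM) ∘L (ContinuousLinearMap.mul ℝ ℂ)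
  have hT : ∀ a b, T a b = (a * b).re := fun a b => rfl
  -- The vanishing of `Im (L 1 + I * L I)`, twice the imaginary part of `∂/∂z̄` of the mollified
  -- `Φ`, is precisely the closedness of the form. The Poincaré lemma on the ball then applies.
  have hω : ∀ x ∈ Metric.ball p R₁, ∃ L : ℂ →L[ℝ] ℂ,
      HasFDerivAt (fun x => T (mollify ρ Φ x)) (T ∘L L) x ∧
        (L 1 + Complex.I * L Complex.I).im = 0 := by
    intro x hx
    obtain ⟨L, hL, hLv⟩ := h.exists_hasFDerivAt_mollify hR hRU hΦ hx
    refine ⟨L, T.hasFDerivAt.comp x hL, ?_⟩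
    have hsub := (h.translate_tsupport_subset x).trans ((closedBall_subset hR hx).trans hRU)
    have hreal := (hpos _ (h.translate_contDiff x) (h.translate_hasCompactSupport x) hsub
      fun w => h.nonneg _).2
    rw [dbarPairing, integral_dbar_mul
      (contDiff_ofReal_comp ((h.translate_contDiff x).of_le (by exact_mod_cast le_top)))
      (hasCompactSupport_ofReal_comp (h.translate_hasCompactSupport x))
      ((tsupport_ofReal_comp_subset _).trans hsub) hΦ] at hreal
    rw [hLv, hLv]
    simp only [Complex.neg_im, Complex.div_ofNat_im, Complex.add_im, Complex.mul_im, Complex.I_re,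
      Complex.I_im, Complex.neg_re] at hreal ⊢
    linarith
  refine Convex.exists_forall_hasFDerivAt_of_fderiv_symmetric (convex_ball p R₁)
    Metric.isOpen_ball (ω := fun x => T (mollify ρ Φ x)) (fun x hx => ?_) fun x hx a b => ?_
  · obtain ⟨L, hL, _⟩ := hω x hx
    exact hL.differentiableAt.differentiableWithinAt
  · obtain ⟨L, hL, hLim⟩ := hω x hx
    rw [hL.fderiv]
    have hexp : ∀ c : ℂ, L c = c.re * L 1 + c.im * L Complex.I := by
      intro c
      have : c = c.re • (1 : ℂ) + c.im • Complex.I := by simp [Complex.re_add_im]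
      conv_lhs => rw [this, map_add, map_smul, map_smul]
      simp
    simp only [ContinuousLinearMap.comp_apply, hT]
    rw [hexp a, hexp b]
    simp only [Complex.add_im, Complex.mul_im, Complex.I_re, Complex.I_im] at hLim
    simp only [Complex.mul_re, Complex.add_re, Complex.add_im, Complex.mul_im, Complex.ofReal_re,
      Complex.ofReal_im]
    linear_combination (a.im * b.re - a.re * b.im) * hLim

end IsMollifier

theorem exists_forall_norm_mollify_sub_le {U : Set ℂ} (hU : IsOpen U) {g : ℂ → ℂ}
    (hg : ContinuousOn g U) {x : ℂ} (hx : x ∈ U) {η : ℝ} (hη : 0 < η) :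
    ∃ ε₀ > 0, ∀ ε ≤ ε₀, ∀ ρ, IsMollifier ρ ε → ‖mollify ρ g x - g x‖ ≤ η := by
  have hcont := hg.continuousAt (hU.mem_nhds hx)
  obtain ⟨δ, hδ, hball⟩ := Metric.continuousAt_iff.1 hcont η hη
  obtain ⟨δ', hδ', hballU⟩ := Metric.isOpen_iff.1 hU x hx
  refine ⟨min δ δ' / 2, by positivity, fun ε hε ρ hρ => ?_⟩
  have hlt : ε < min δ δ' := by
    have : 0 < min δ δ' := lt_min hδ hδ'
    linarith
  have hsub : Metric.closedBall x ε ⊆ U :=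
    (Metric.closedBall_subset_ball (hlt.trans_le (min_le_right _ _))).trans hballU
  have e := hρ.mollify_sub hsub (hg.locallyIntegrableOn hU.measurableSet)
    ((continuousOn_const (c := g x)).locallyIntegrableOn hU.measurableSet)
  rw [hρ.mollify_const] at e
  rw [← e]
  refine hρ.norm_mollify_le (Filter.Eventually.of_forall fun w hw => ?_)
  rw [← dist_eq_norm]
  exact (hball ((Metric.mem_closedBall.1 hw).trans_lt (hlt.trans_le (min_le_left _ _)))).le

theorem le_of_hasFDerivAt_segment {Q : ℂ → ℝ} {D : ℂ → ℂ →L[ℝ] ℝ} {a b : ℂ}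
    (hQ : ∀ x ∈ segment ℝ a b, HasFDerivAt Q (D x) x)
    (hD : ∀ x ∈ segment ℝ a b, D x (b - a) ≤ 0) : Q b ≤ Q a := by
  have hmem : ∀ σ ∈ Set.Icc (0 : ℝ) 1, a + (σ : ℂ) * (b - a) ∈ segment ℝ a b := by
    intro σ hσ
    rw [segment_eq_image']
    exact ⟨σ, hσ, by simp⟩
  have hd : ∀ σ ∈ Set.Icc (0 : ℝ) 1, HasDerivAt (fun σ : ℝ => Q (a + (σ : ℂ) * (b - a)))
      (D (a + (σ : ℂ) * (b - a)) (b - a)) σ := by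
    intro σ hσ
    have hlin : HasDerivAt (fun σ : ℝ => a + (σ : ℂ) * (b - a)) (b - a) σ := by
      simpa using ((Complex.ofRealCLM.hasDerivAt (x := σ)).mul_const (b - a)).const_add a
    exact (hQ _ (hmem σ hσ)).comp_hasDerivAt σ hlin
  have hanti := antitoneOn_of_deriv_nonpos (convex_Icc (0 : ℝ) 1)
    (f := fun σ : ℝ => Q (a + (σ : ℂ) * (b - a)))
    (fun σ hσ => (hd σ hσ).continuousAt.continuousWithinAt)
    (fun σ hσ => (hd σ (interior_subset hσ)).differentiableAt.differentiableWithinAt)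
    (fun σ hσ => by
      rw [(hd σ (interior_subset hσ)).deriv]
      exact hD _ (hmem σ (interior_subset hσ)))
    (Set.left_mem_Icc.2 zero_le_one) (Set.right_mem_Icc.2 zero_le_one) zero_le_one
  simpa using hanti

theorem exists_closedBall_subset_of_segment_subset {M : Set ℂ} (hM : IsOpen M) {a b : ℂ}
    (hab : segment ℝ a b ⊆ M) :
    ∃ ε₀ > 0, ∀ ε ≤ ε₀, ∀ x ∈ segment ℝ a b, Metric.closedBall x ε ⊆ M := by
  have hcomp : IsCompact (segment ℝ a b) := by
    rw [segment_eq_image']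
    exact isCompact_Icc.image (by fun_prop)
  obtain ⟨δ, hδ, hsub⟩ := hcomp.exists_cthickening_subset_open hM hab
  exact ⟨δ, hδ, fun ε hε x hx => (Metric.closedBall_subset_closedBall hε).trans
    ((Metric.closedBall_subset_cthickening hx δ).trans hsub)⟩

/-! ### Comparison of the harmonic functions near `p` -/

namespace IsMaximalPartition

variable {ι : Type*} {U : Set ℂ} {Φ : ℂ → ℂ} {A : ι → ℂ → ℂ} {M : ι → Set ℂ}

/-- With `Ψ` a primitive of the mollified `Re (Φ dz)`, the function `Ψ - Re f_k` takes equal values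
at `z`, `a`, `p'`, and `Ψ - Re f_j` takes equal values at `p''`, `b` and does not increase from `z`
to `b`. Eliminating `Ψ z` leaves `Ψ p' - Ψ p''`, bounded by the Lipschitz constant `C`. Here `f_k`,
`f_j` are mollified too, whence the four errors `η / 4`. -/
theorem re_primitive_sub_le (h : IsMaximalPartition U Φ A M) (hU : IsOpen U)
    (hΦ : LocallyIntegrableOn Φ U volume) (hpos : DbarNonneg U Φ)
    (hA : ∀ i, DifferentiableOn ℂ (A i) U) {f : ι → ℂ → ℂ}
    (hf : ∀ i, ∀ z ∈ U, HasDerivAt (f i) (A i z) z) {p : ℂ} {R R₁ C : ℝ} (hR : R₁ < R)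
    (hRU : Metric.closedBall p R ⊆ U)
    (hC : ∀ᵐ w, w ∈ Metric.closedBall p R → ‖Φ w‖ ≤ C) {k j : ι} {z a b p' p'' : ℂ}
    (hz : z ∈ Metric.ball p R₁) (ha : a ∈ Metric.ball p R₁) (hb : b ∈ Metric.ball p R₁)
    (hp' : p' ∈ Metric.ball p R₁) (hp'' : p'' ∈ Metric.ball p R₁) (hza : segment ℝ z a ⊆ M k)
    (hpa : segment ℝ p' a ⊆ M k) (hpb : segment ℝ p'' b ⊆ M j)
    (hle : ∀ᵐ w, w ∈ Metric.closedBall p R → ((Φ w - A j w) * (b - z)).re ≤ 0) :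
    (f j z - f j p'').re ≤ (f k z - f k p').re + C * ‖p' - p''‖ := by
  have hfc : ∀ i, ContinuousOn (f i) U := fun i z hz =>
    (hf i z hz).continuousAt.continuousWithinAt
  have hOU : Metric.ball p R₁ ⊆ U :=
    ((Metric.ball_subset_ball hR.le).trans Metric.ball_subset_closedBall).trans hRU
  refine le_of_forall_pos_le_add fun η hη => ?_
  have hη4 : 0 < η / 4 := by positivity
  obtain ⟨ε₁, hε₁, h₁⟩ := exists_forall_norm_mollify_sub_le hU (hfc j) (hOU hz) hη4
  obtain ⟨ε₂, hε₂, h₂⟩ := exists_forall_norm_mollify_sub_le hU (hfc j) (hOU hp'') hη4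
  obtain ⟨ε₃, hε₃, h₃⟩ := exists_forall_norm_mollify_sub_le hU (hfc k) (hOU hz) hη4
  obtain ⟨ε₄, hε₄, h₄⟩ := exists_forall_norm_mollify_sub_le hU (hfc k) (hOU hp') hη4
  obtain ⟨ε₅, hε₅, h₅⟩ := exists_closedBall_subset_of_segment_subset (h.isOpen k) hza
  obtain ⟨ε₆, hε₆, h₆⟩ := exists_closedBall_subset_of_segment_subset (h.isOpen k) hpa
  obtain ⟨ε₇, hε₇, h₇⟩ := exists_closedBall_subset_of_segment_subset (h.isOpen j) hpb
  obtain ⟨ε, hε0, hεR, hε⟩ : ∃ ε > 0, R₁ + ε ≤ R ∧ ε ≤ ε₁ ∧ ε ≤ ε₂ ∧ ε ≤ ε₃ ∧ ε ≤ ε₄ ∧ ε ≤ ε₅ ∧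
      ε ≤ ε₆ ∧ ε ≤ ε₇ := by
    have hev : ∀ᶠ ε in nhdsWithin (0 : ℝ) (Set.Ioi 0), ε < R - R₁ ∧ ε < ε₁ ∧ ε < ε₂ ∧ ε < ε₃ ∧
        ε < ε₄ ∧ ε < ε₅ ∧ ε < ε₆ ∧ ε < ε₇ := by
      refine Filter.Eventually.filter_mono nhdsWithin_le_nhds ?_
      simp only [Filter.eventually_and]
      exact ⟨eventually_lt_nhds (sub_pos.2 hR), eventually_lt_nhds hε₁, eventually_lt_nhds hε₂,
        eventually_lt_nhds hε₃, eventually_lt_nhds hε₄, eventually_lt_nhds hε₅,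
        eventually_lt_nhds hε₆, eventually_lt_nhds hε₇⟩
    obtain ⟨ε, ⟨e0, e1, e2, e3, e4, e5, e6, e7⟩, hpos⟩ := (hev.and self_mem_nhdsWithin).exists
    exact ⟨ε, hpos, by linarith, e1.le, e2.le, e3.le, e4.le, e5.le, e6.le, e7.le⟩
  obtain ⟨hε1, hε2, hε3, hε4, hε5, hε6, hε7⟩ := hε
  obtain ⟨ρ, hρ⟩ := exists_isMollifier hε0
  obtain ⟨Ψ, hΨ⟩ := hρ.exists_primitive hεR hRU hΦ hpos
  have hAl : ∀ i, LocallyIntegrableOn (A i) U volume := fun i =>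
    (hA i).continuousOn.locallyIntegrableOn hU.measurableSet
  set Q : ι → ℂ → ℝ := fun i x => Ψ x - (mollify ρ (f i) x).re with hQdef
  have hQ : ∀ i, ∀ x ∈ Metric.ball p R₁, ∃ D : ℂ →L[ℝ] ℝ, HasFDerivAt (Q i) D x ∧
      ∀ v, D v = (mollify ρ (fun w => Φ w - A i w) x * v).re := by
    intro i x hx
    refine ⟨_, (hΨ x hx).sub (Complex.reCLM.hasFDerivAt.comp x
      (hρ.hasFDerivAt_mollify_primitive hU hεR hRU (hf i) (hA i).continuousOn hx)), fun v => ?_⟩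
    rw [hρ.mollify_sub ((IsMollifier.closedBall_subset hεR hx).trans hRU) hΦ (hAl i), sub_mul,
      Complex.sub_re]
    rfl
  choose! D hD hDv using hQ
  have hseg : ∀ {x y : ℂ}, x ∈ Metric.ball p R₁ → y ∈ Metric.ball p R₁ →
      segment ℝ x y ⊆ Metric.ball p R₁ := fun hx hy => (convex_ball p R₁).segment_subset hx hy
  have hconst : ∀ i {x y : ℂ}, x ∈ Metric.ball p R₁ → y ∈ Metric.ball p R₁ →
      (∀ w ∈ segment ℝ x y, Metric.closedBall w ε ⊆ M i) → Q i y = Q i x := by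
    intro i x y hx hy hM
    have h0 : ∀ w ∈ segment ℝ x y, ∀ v, D i w v = 0 := by
      intro w hw v
      rw [hDv i w (hseg hx hy hw), hρ.mollify_eq_zero, zero_mul, Complex.zero_re]
      filter_upwards [h.ae_eq i] with u hu hub
      rw [hu (hM w hw hub), sub_self]
    refine le_antisymm ?_ ?_
    · exact le_of_hasFDerivAt_segment (fun w hw => hD i w (hseg hx hy hw))
        fun w hw => (h0 w hw _).le
    · refine le_of_hasFDerivAt_segment (D := D i) (fun w hw => hD i w (hseg hy hx hw))
        fun w hw => (h0 w ?_ _).le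
      rwa [segment_symm]
  have e1 := hconst k hz ha (h₅ ε hε5)
  have e2 := hconst k hp' ha (h₆ ε hε6)
  have e3 := hconst j hp'' hb (h₇ ε hε7)
  have e4 : Q j b ≤ Q j z := by
    refine le_of_hasFDerivAt_segment (fun w hw => hD j w (hseg hz hb hw)) fun w hw => ?_
    have hwO := hseg hz hb hw
    rw [hDv j w hwO]
    refine hρ.mollify_mul_re_nonpos ((IsMollifier.closedBall_subset hεR hwO).trans hRU)
      (hΦ.sub (hAl j)) ?_
    filter_upwards [hle] with u hu hub
    exact hu (IsMollifier.closedBall_subset hεR hwO hub)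
  -- Averaging preserves the bound `C` for `|Φ|`, so this Lipschitz estimate does not depend on `ε`.
  have e5 : Ψ p' - Ψ p'' ≤ C * ‖p' - p''‖ := by
    have := (convex_ball p R₁).norm_image_sub_le_of_norm_hasFDerivWithin_le (C := C)
      (fun x hx => (hΨ x hx).hasFDerivWithinAt) (fun x hx => ?_) hp'' hp'
    · exact (le_abs_self _).trans this
    · have hm : ‖mollify ρ Φ x‖ ≤ C := hρ.norm_mollify_le (by
        filter_upwards [hC] with u hu hub
        exact hu (IsMollifier.closedBall_subset hεR hx hub))
      refine ContinuousLinearMap.opNorm_le_bound _ ((norm_nonneg _).trans hm) fun v => ?_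
      change |(mollify ρ Φ x * v).re| ≤ C * ‖v‖
      refine (Complex.abs_re_le_norm _).trans ?_
      rw [norm_mul]
      exact mul_le_mul_of_nonneg_right hm (norm_nonneg _)
  have hre : ∀ u w : ℂ, ‖u - w‖ ≤ η / 4 → |u.re - w.re| ≤ η / 4 := fun u w huw =>
    ((Complex.sub_re u w) ▸ Complex.abs_re_le_norm (u - w)).trans huw
  have b1 := abs_le.1 (hre _ _ (h₁ ε hε1 ρ hρ))
  have b2 := abs_le.1 (hre _ _ (h₂ ε hε2 ρ hρ))
  have b3 := abs_le.1 (hre _ _ (h₃ ε hε3 ρ hρ))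
  have b4 := abs_le.1 (hre _ _ (h₄ ε hε4 ρ hρ))
  simp only [hQdef, Complex.sub_re] at e1 e2 e3 e4 ⊢
  linarith [b1.1, b1.2, b2.1, b2.2, b3.1, b3.2, b4.1, b4.2]

variable [Finite ι]

/-- Near `p`, on each piece that accumulates at `p` the corresponding harmonic function is the
largest one. -/
theorem exists_ball_re_primitive_le (h : IsMaximalPartition U Φ A M) (hU : IsOpen U)
    (hΦ : LocallyIntegrableOn Φ U volume) (hpos : DbarNonneg U Φ)
    (hA : ∀ i, DifferentiableOn ℂ (A i) U) {f : ι → ℂ → ℂ}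
    (hf : ∀ i, ∀ z ∈ U, HasDerivAt (f i) (A i z) z)
    (hE : ∀ i j k, i ≠ j → i ≠ k → j ≠ k → Measure.hausdorffMeasure 1
      (U ∩ (frontier (M i) ∩ frontier (M j) ∩ frontier (M k))) = 0)
    {p : ℂ} (hp : p ∈ U)
    (hcone : ∀ k, p ∈ closure (M k) → ∃ v : ℂ, ∀ j, p ∈ closure (M j) → j ≠ k →
      0 < ((A k p - A j p) * v).re) :
    ∃ R' > 0, Metric.closedBall p R' ⊆ U ∧
      (∀ i, p ∉ closure (M i) → Disjoint (Metric.ball p R') (M i)) ∧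
      ∀ k j, p ∈ closure (M k) → p ∈ closure (M j) → ∀ z ∈ M k ∩ Metric.ball p R',
        (f j z - f j p).re ≤ (f k z - f k p).re := by
  cases nonempty_fintype ι
  choose! v hv using hcone
  obtain ⟨δ, hδ, hδv⟩ : ∃ δ > 0, ∀ e₁ e₂ : ℂ, ‖e₁‖ < δ → ‖e₂‖ < δ → ∀ k j,
      p ∈ closure (M k) → p ∈ closure (M j) → j ≠ k →
        0 < ((A k (p + e₁) - A j (p + e₁)) * (v k + e₂)).re := by
    have hev : ∀ᶠ e : ℂ × ℂ in nhds 0, ∀ k j, p ∈ closure (M k) → p ∈ closure (M j) → j ≠ k →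
        0 < ((A k (p + e.1) - A j (p + e.1)) * (v k + e.2)).re := by
      refine Filter.eventually_all.2 fun k => Filter.eventually_all.2 fun j => ?_
      by_cases hkj : p ∈ closure (M k) ∧ p ∈ closure (M j) ∧ j ≠ k
      · have hAc : ∀ i, ContinuousAt (fun e : ℂ × ℂ => A i (p + e.1)) 0 := by
          intro i
          have h1 : ContinuousAt (A i) (p + (0 : ℂ × ℂ).1) := by
            simpa using ((hA i).differentiableAt (hU.mem_nhds hp)).continuousAt
          exact ContinuousAt.comp (f := fun e : ℂ × ℂ => p + e.1) h1 (by fun_prop)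
        have hc : ContinuousAt (fun e : ℂ × ℂ =>
            ((A k (p + e.1) - A j (p + e.1)) * (v k + e.2)).re) 0 :=
          Complex.continuous_re.continuousAt.comp
            (((hAc k).sub (hAc j)).mul (by fun_prop))
        have h0 := hc.eventually (lt_mem_nhds (a := (0 : ℝ))
          (by simpa using hv k hkj.1 j hkj.2.1 hkj.2.2))
        filter_upwards [h0] with e he _ _ _ using he
      · exact Filter.Eventually.of_forall fun e h1 h2 h3 => absurd ⟨h1, h2, h3⟩ hkj
    obtain ⟨δ, hδ, hball⟩ := Metric.eventually_nhds_iff.1 hev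
    refine ⟨δ, hδ, fun e₁ e₂ h1 h2 => hball (y := (e₁, e₂)) ?_⟩
    rw [dist_zero_right, Prod.norm_def]
    exact max_lt h1 h2
  obtain ⟨R₀, hR₀, hR₀δ, hR₀U, hR₀d⟩ : ∃ R₀ > 0, R₀ ≤ δ ∧ Metric.ball p R₀ ⊆ U ∧
      ∀ i, p ∉ closure (M i) → Disjoint (Metric.ball p R₀) (M i) := by
    have hev : ∀ᶠ w in nhds p, w ∈ U ∧ ∀ i, p ∉ closure (M i) → w ∉ M i := by
      refine (hU.eventually_mem hp).and (Filter.eventually_all.2 fun i => ?_)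
      by_cases hi : p ∈ closure (M i)
      · exact Filter.Eventually.of_forall fun w hw => absurd hi hw
      · filter_upwards [isClosed_closure.isOpen_compl.mem_nhds hi] with w hw _ hwi
        exact hw (subset_closure hwi)
    obtain ⟨s, hs, hball⟩ := Metric.eventually_nhds_iff_ball.1 hev
    refine ⟨min s δ, lt_min hs hδ, min_le_right _ _, fun w hw => ?_, fun i hi => ?_⟩
    · exact (hball w (Metric.ball_subset_ball (min_le_left _ _) hw)).1
    · rw [Set.disjoint_left]
      exact fun w hw => (hball w (Metric.ball_subset_ball (min_le_left _ _) hw)).2 i hi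
  set N := Metric.ball p R₀
  have hdir : ∀ k, p ∈ closure (M k) → ∀ u : ℂ, ‖u - v k‖ < δ → ∀ j, j ≠ k →
      Disjoint N (M j) ∨ ∀ z ∈ N, 0 < ((A k z - A j z) * u).re := by
    intro k hk u hu j hjk
    by_cases hj : p ∈ closure (M j)
    · refine Or.inr fun z hz => ?_
      have := hδv (z - p) (u - v k) ((mem_ball_iff_norm.1 hz).trans_le hR₀δ) hu k j hk hj hjk
      simpa using this
    · exact Or.inl (hR₀d j hj)
  have htrans : ∀ k, p ∈ closure (M k) → ∀ u : ℂ, ‖u - v k‖ < δ → ∀ x ∈ M k, x ∈ N →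
      ∀ t : ℝ, 0 ≤ t → x + t * u ∈ N → x + t * u ∈ M k := fun k hk u hu x hx hxN t ht hxt =>
    h.add_mul_mem hΦ hpos hA Metric.isOpen_ball (convex_ball p R₀) hR₀U hE (hdir k hk u hu) hx hxN
      ht hxt
  have hconeM : ∀ k, p ∈ closure (M k) → ∀ u : ℂ, ‖u - v k‖ < δ → ∀ t : ℝ, 0 < t →
      p + t * u ∈ N → p + t * u ∈ M k := by
    intro k hk u hu t ht hptN
    -- The point `p + t u` is reached from a nearby `x ∈ M k` in the corrected direction `u + (p -
    -- x) / t`; the second bound keeps that direction within `δ` of `v k`.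
    obtain ⟨x, hx, hxp⟩ := Metric.mem_closure_iff.1 hk (min R₀ (t * (δ - ‖u - v k‖)))
      (lt_min hR₀ (mul_pos ht (sub_pos.2 hu)))
    have htc : (t : ℂ) ≠ 0 := by exact_mod_cast ht.ne'
    have e : x + t * (u + (p - x) / t) = p + t * u := by field_simp; ring
    rw [← e] at hptN ⊢
    refine htrans k hk _ ?_ x hx ?_ t ht.le hptN
    · have h1 : ‖(p - x) / t‖ < δ - ‖u - v k‖ := by
        rw [norm_div, Complex.norm_real, Real.norm_of_nonneg ht.le, div_lt_iff₀ ht, mul_comm,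
          ← dist_eq_norm]
        exact hxp.trans_le (min_le_right _ _)
      calc ‖u + (p - x) / t - v k‖ = ‖(u - v k) + (p - x) / t‖ := by congr 1; ring
        _ ≤ ‖u - v k‖ + ‖(p - x) / t‖ := norm_add_le _ _
        _ < δ := by linarith
    · rw [Metric.mem_ball, dist_comm]
      exact hxp.trans_le (min_le_left _ _)
  obtain ⟨V, hV, hvV⟩ : ∃ V > 0, ∀ k, ‖v k‖ ≤ V :=
    ⟨∑ k, ‖v k‖ + 1, by positivity, fun k =>
      (Finset.single_le_sum (fun i _ => norm_nonneg (v i)) (Finset.mem_univ k)).trans (by simp)⟩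
  -- Each step `s v k` has length at most `R₀ / 16`, so starting within `R₀ / 16` of `p` keeps all
  -- the paths in the ball of radius `R₀ / 4`.
  set s := R₀ / (16 * V) with hs
  have hs0 : 0 < s := by positivity
  have hsV : ∀ k, ‖(s : ℂ) * v k‖ ≤ R₀ / 16 := by
    intro k
    rw [norm_mul, Complex.norm_real, Real.norm_of_nonneg hs0.le]
    calc s * ‖v k‖ ≤ s * V := mul_le_mul_of_nonneg_left (hvV k) hs0.le
      _ = R₀ / 16 := by rw [hs]; field_simp
  have hsc : (s : ℂ) ≠ 0 := by exact_mod_cast hs0.ne'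
  have hballs : Metric.ball p (R₀ / 4) ⊆ N := Metric.ball_subset_ball (by linarith)
  have hcb : Metric.closedBall p (R₀ / 2) ⊆ N := Metric.closedBall_subset_ball (by linarith)
  obtain ⟨C, hC⟩ : ∃ C : ℝ, ∀ i, ∀ w ∈ Metric.closedBall p (R₀ / 2), ‖A i w‖ ≤ C := by
    have : ∀ i, ∃ c : ℝ, ∀ w ∈ Metric.closedBall p (R₀ / 2), ‖A i w‖ ≤ c := fun i =>
      (isCompact_closedBall p (R₀ / 2)).exists_bound_of_continuousOn
        ((hA i).continuousOn.mono (hcb.trans hR₀U))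
    choose c hc using this
    exact ⟨∑ i, |c i|, fun i w hw => (hc i w hw).trans ((le_abs_self _).trans
      (Finset.single_le_sum (fun i _ => abs_nonneg (c i)) (Finset.mem_univ i)))⟩
  have hCΦ : ∀ᵐ w, w ∈ Metric.closedBall p (R₀ / 2) → ‖Φ w‖ ≤ C := by
    filter_upwards [h.ae_cover, Filter.eventually_all.2 h.ae_eq] with w hw hwA hwb
    obtain ⟨i, hi⟩ := hw (hR₀U (hcb hwb))
    rw [hwA i hi]
    exact hC i w hwb
  -- The bound `s * δ / 2` makes `(z - p) / s` shorter than `δ`, so that `z + s v i = p + s (v i +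
  -- (z - p) / s)` lies in the cone at `p` contained in `M i`.
  refine ⟨min (R₀ / 16) (s * δ / 2), by positivity, ?_, fun i hi => ?_, ?_⟩
  · exact (Metric.closedBall_subset_ball ((min_le_left _ _).trans_lt (by linarith))).trans hR₀U
  · exact (hR₀d i hi).mono_left
      (Metric.ball_subset_ball ((min_le_left _ _).trans (by linarith)))
  intro k j hk hj z ⟨hzk, hzb⟩
  have hz1 : ‖z - p‖ < R₀ / 16 := (mem_ball_iff_norm.1 hzb).trans_le (min_le_left _ _)
  have hz2 : ‖z - p‖ < s * δ / 2 := (mem_ball_iff_norm.1 hzb).trans_le (min_le_right _ _)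
  have hzb4 : z ∈ Metric.ball p (R₀ / 4) := by rw [mem_ball_iff_norm]; linarith
  have hpb4 : p ∈ Metric.ball p (R₀ / 4) := Metric.mem_ball_self (by positivity)
  have hab : ∀ i, z + s * v i ∈ Metric.ball p (R₀ / 4) := by
    intro i
    rw [mem_ball_iff_norm]
    calc ‖z + s * v i - p‖ = ‖(z - p) + s * v i‖ := by congr 1; ring
      _ ≤ ‖z - p‖ + ‖(s : ℂ) * v i‖ := norm_add_le _ _
      _ < R₀ / 4 := by linarith [hsV i]
  have hray : ∀ i, p ∈ closure (M i) → ∀ τ ∈ Set.Ioc (0 : ℝ) 1,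
      p + τ * (z + s * v i - p) ∈ Metric.ball p (R₀ / 4) ∧
        p + τ * (z + s * v i - p) ∈ M i := by
    intro i hi τ hτ
    have hmem : p + τ * (z + s * v i - p) ∈ Metric.ball p (R₀ / 4) := by
      have := (convex_ball p (R₀ / 4)) hpb4 (hab i) (a := 1 - τ) (b := τ) (by linarith [hτ.2])
        hτ.1.le (by ring)
      convert this using 1
      simp only [Complex.real_smul]
      push_cast
      ring
    refine ⟨hmem, ?_⟩
    have e : p + τ * (z + s * v i - p) = p + (τ * s : ℝ) * (v i + (z - p) / s) := by
      push_cast; field_simp; ring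
    have := hconeM i hi (v i + (z - p) / s) (by
      rw [add_sub_cancel_left, norm_div, Complex.norm_real, Real.norm_of_nonneg hs0.le,
        div_lt_iff₀ hs0]
      nlinarith) (τ * s) (mul_pos hτ.1 hs0)
    rw [← e] at this
    exact this (hballs hmem)
  have hsegray : ∀ i, p ∈ closure (M i) → ∀ τ ∈ Set.Ioc (0 : ℝ) 1,
      segment ℝ (p + τ * (z + s * v i - p)) (z + s * v i) ⊆ M i := by
    intro i hi τ hτ
    rw [segment_eq_image']
    rintro _ ⟨θ, hθ, rfl⟩
    have := (hray i hi (τ + θ * (1 - τ))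
      ⟨by nlinarith [hτ.1, hτ.2, hθ.1], by nlinarith [hτ.1, hτ.2, hθ.1, hθ.2]⟩).2
    convert this using 1
    simp only [Complex.real_smul]
    push_cast
    ring
  have hza : segment ℝ z (z + s * v k) ⊆ M k := by
    intro x hx
    have hxN := hballs ((convex_ball p (R₀ / 4)).segment_subset hzb4 (hab k) hx)
    rw [segment_eq_image'] at hx
    obtain ⟨θ, hθ, rfl⟩ := hx
    have e : z + θ • (z + s * v k - z) = z + (θ * s : ℝ) * v k := by
      simp only [Complex.real_smul]
      push_cast
      ring
    simp only [e] at hxN ⊢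
    exact htrans k hk (v k) (by simpa using hδ) z hzk (hballs hzb4) _
      (mul_nonneg hθ.1 hs0.le) hxN
  have hle : ∀ᵐ w, w ∈ Metric.closedBall p (R₀ / 2) →
      ((Φ w - A j w) * (z + s * v j - z)).re ≤ 0 := by
    filter_upwards [h.ae_cover, Filter.eventually_all.2 h.ae_eq] with w hw hwA hwb
    obtain ⟨i, hi⟩ := hw (hR₀U (hcb hwb))
    rw [hwA i hi]
    by_cases hij : i = j
    · simp [hij]
    · have h1 := ((hdir j hj (v j) (by simpa using hδ) i hij).resolve_left
        fun hd => Set.disjoint_left.1 hd (hcb hwb) hi) w (hcb hwb)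
      have e : (A i w - A j w) * (z + s * v j - z) = ((-s : ℝ) : ℂ) * ((A j w - A i w) * v j) := by
        push_cast; ring
      rw [e, Complex.re_ofReal_mul]
      nlinarith
  -- The cone is open and omits its vertex, so the paths stop at points `p'`, `p''` at parameter `τ
  -- > 0` on their rays; both tend to `p` as `τ → 0`.
  have key : ∀ τ ∈ Set.Ioc (0 : ℝ) 1,
      (f j z - f j (p + τ * (z + s * v j - p))).re ≤
        (f k z - f k (p + τ * (z + s * v k - p))).re +
          C * ‖(p + τ * (z + s * v k - p)) - (p + τ * (z + s * v j - p))‖ := fun τ hτ =>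
    h.re_primitive_sub_le hU hΦ hpos hA hf (R₁ := R₀ / 4) (R := R₀ / 2) (by linarith)
      (hcb.trans hR₀U) hCΦ hzb4 (hab k) (hab j) (hray k hk τ hτ).1 (hray j hj τ hτ).1 hza
      (hsegray k hk τ hτ) (hsegray j hj τ hτ) hle
  have hpt : ∀ i, Filter.Tendsto (fun τ : ℝ => p + (τ : ℂ) * (z + s * v i - p))
      (nhdsWithin 0 (Set.Ioi 0)) (nhds p) := by
    intro i
    have hc : Continuous fun τ : ℝ => p + (τ : ℂ) * (z + s * v i - p) := by fun_prop
    have := hc.tendsto 0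
    simp only [Complex.ofReal_zero, zero_mul, add_zero] at this
    exact this.mono_left nhdsWithin_le_nhds
  have hft : ∀ l i, Filter.Tendsto (fun τ : ℝ => (f l z - f l (p + (τ : ℂ) * (z + s * v i - p))).re)
      (nhdsWithin 0 (Set.Ioi 0)) (nhds (f l z - f l p).re) := fun l i =>
    (Complex.continuous_re.tendsto _).comp
      (tendsto_const_nhds.sub ((hf l p hp).continuousAt.tendsto.comp (hpt i)))
  have hnt := (((hpt k).sub (hpt j)).norm.const_mul C)
  rw [sub_self, norm_zero, mul_zero] at hnt
  have hlim := (hft k k).add hnt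
  rw [add_zero] at hlim
  refine le_of_tendsto_of_tendsto (hft j j) hlim ?_
  filter_upwards [Ioc_mem_nhdsGT (zero_lt_one (α := ℝ))] with τ hτ using key τ hτ

end IsMaximalPartition

/-! ### Separating directions from the cone condition -/

/-- If no nontrivial nonnegative combination of the `d j` vanishes, then the `d j` lie in an open
half-plane. -/
theorem exists_forall_re_mul_pos {ι : Type*} [Fintype ι] (J : Finset ι) (d : ι → ℂ)
    (h : ∀ θ : ι → ℝ, (∀ j ∈ J, 0 ≤ θ j) → 0 < ∑ j ∈ J, θ j → ∑ j ∈ J, (θ j : ℂ) * d j ≠ 0) :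
    ∃ v : ℂ, ∀ j ∈ J, 0 < (d j * v).re := by
  classical
  set S : Set (ι → ℝ) := stdSimplex ℝ ι ∩ {θ | ∀ j ∉ J, θ j = 0} with hS
  have hSset : {θ : ι → ℝ | ∀ j ∉ J, θ j = 0} = ⋂ j ∈ {j | j ∉ J}, {θ : ι → ℝ | θ j = 0} := by
    ext θ; simp
  have hScomp : IsCompact S := by
    refine (isCompact_stdSimplex ℝ ι).inter_right ?_
    rw [hSset]
    exact isClosed_biInter fun j _ => isClosed_eq (continuous_apply j) continuous_const
  have hSconv : Convex ℝ S := by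
    refine (convex_stdSimplex ℝ ι).inter fun θ hθ θ' hθ' a b _ _ _ j hj => ?_
    simp [hθ j hj, hθ' j hj]
  let T : (ι → ℝ) →L[ℝ] ℂ :=
    ∑ j, (ContinuousLinearMap.proj (R := ℝ) (φ := fun _ : ι => ℝ) j).smulRight (d j)
  have hT : ∀ θ, T θ = ∑ j, (θ j : ℂ) * d j := by
    intro θ
    simp [T]
  -- `T '' S` is the convex hull of the `d j`, `j ∈ J`: it is compact, and normalised coefficients
  -- have sum `1 > 0`. It can thus be strictly separated from `0`.
  have h0 : (0 : ℂ) ∉ T '' S := by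
    rintro ⟨θ, ⟨hθ, hθJ⟩, h0⟩
    have hsum : ∀ {E : Type} [AddCommMonoid E] (g : ι → E), (∀ j ∉ J, g j = 0) →
        ∑ j ∈ J, g j = ∑ j, g j := fun g hg =>
      Finset.sum_subset (Finset.subset_univ J) fun j _ hj => hg j hj
    refine h θ (fun j _ => hθ.1 j) ?_ ?_
    · rw [hsum θ hθJ, hθ.2]
      exact one_pos
    · rw [hsum (fun j => (θ j : ℂ) * d j) fun j hj => by simp [hθJ j hj], ← hT, h0]
  obtain ⟨g, u, hu0, hu⟩ := geometric_hahn_banach_point_closed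
    (hSconv.linear_image (T : (ι → ℝ) →ₗ[ℝ] ℂ)) (hScomp.image T.continuous).isClosed h0
  rw [map_zero] at hu0
  -- Every real linear functional on the plane is `w ↦ Re (w v)` with `v = g 1 - I g I`.
  refine ⟨(g 1 : ℂ) - g Complex.I * Complex.I, fun j hj => ?_⟩
  have hmem : d j ∈ T '' S := by
    refine ⟨Pi.single j 1, ⟨single_mem_stdSimplex ℝ j, fun i hi => ?_⟩, ?_⟩
    · exact Pi.single_eq_of_ne (fun hij => hi (by rw [hij]; exact hj)) _
    · rw [hT, Finset.sum_eq_single j]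
      · simp
      · intro i _ hij
        simp [Pi.single_eq_of_ne hij]
      · simp
  have hgd : g (d j) = (d j * ((g 1 : ℂ) - g Complex.I * Complex.I)).re := by
    have : d j = (d j).re • (1 : ℂ) + (d j).im • Complex.I := by simp [Complex.re_add_im]
    conv_lhs => rw [this, map_add, map_smul, map_smul]
    simp
  rw [← hgd]
  exact hu0.trans (hu _ hmem)

/-! ### The maximum function and its distributional derivative -/

section MaxHarmonic

variable {r : ℕ} {I : Finset (Fin r)} {f : Fin r → ℂ → ℂ} {p : ℂ}

theorem harmonicFromPrimitive_le_maxHarmonic {j : Fin r} (hj : j ∈ I) (z : ℂ) :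
    harmonicFromPrimitive (f j) p z ≤ maxHarmonic I f p z :=
  le_ciSup (f := fun j : I => harmonicFromPrimitive (f j) p z) (Set.finite_range _).bddAbove
    ⟨j, hj⟩

theorem maxHarmonic_le (hI : I.Nonempty) {z : ℂ} {c : ℝ}
    (h : ∀ j ∈ I, harmonicFromPrimitive (f j) p z ≤ c) : maxHarmonic I f p z ≤ c := by
  have := hI.to_subtype
  exact ciSup_le fun j => h j j.2

/-- A common Lipschitz constant for the `f i` passes to their real parts and to the maximum. The
Lipschitz property is what ensures that the almost-everywhere derivative is the whole distributional
derivative. -/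
theorem exists_lipschitzOnWith_maxHarmonic (hI : I.Nonempty) {A : Fin r → ℂ → ℂ} {s : Set ℂ}
    (hs : Convex ℝ s) (hsc : IsCompact s) (hf : ∀ i, ∀ z ∈ s, HasDerivAt (f i) (A i z) z)
    (hA : ∀ i, ContinuousOn (A i) s) : ∃ C, LipschitzOnWith C (maxHarmonic I f p) s := by
  choose c hc using fun i => hsc.exists_bound_of_continuousOn (hA i)
  set C : NNReal := ∑ i, (c i).toNNReal
  have hcC : ∀ i, c i ≤ C := fun i => (Real.le_coe_toNNReal _).trans
    (NNReal.coe_le_coe.2 (Finset.single_le_sum (f := fun i => (c i).toNNReal)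
      (fun i _ => zero_le) (Finset.mem_univ i)))
  have hlip : ∀ i, LipschitzOnWith C (f i) s := fun i =>
    hs.lipschitzOnWith_of_nnnorm_hasDerivWithin_le (fun z hz => (hf i z hz).hasDerivWithinAt)
      fun z hz => (hc i z hz).trans (hcC i)
  refine ⟨C, LipschitzOnWith.of_le_add_mul C fun x hx y hy => maxHarmonic_le hI fun j hj => ?_⟩
  have h1 : (f j x - f j y).re ≤ C * dist x y := by
    refine (Complex.re_le_norm _).trans ?_
    rw [← dist_eq_norm]
    exact (hlip j).dist_le_mul x hx y hy
  have h2 := harmonicFromPrimitive_le_maxHarmonic (f := f) (p := p) hj y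
  simp only [harmonicFromPrimitive, Complex.sub_re] at h1 h2 ⊢
  linarith

end MaxHarmonic

theorem MeasureTheory.LocallyIntegrableOn.div_const {g : ℂ → ℂ} {s : Set ℂ}
    (hg : LocallyIntegrableOn g s volume) (c : ℂ) :
    LocallyIntegrableOn (fun z => g z / c) s volume := fun x hx =>
  let ⟨t, ht, hi⟩ := hg x hx
  ⟨t, ht, Integrable.div_const hi c⟩

/-- A Lipschitz function `φ` whose gradient is a.e. given by `Φ`, in the sense that the derivative
in the direction `v` is `Re (Φ v)`, has the distributional derivative `∂φ/∂z = Φ / 2`. -/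
theorem functionDistribution_half_eq_distribDz {N : Opens ℂ} {Φ : ℂ → ℂ} {φ : ℂ → ℝ}
    (hΦ : LocallyIntegrableOn Φ (N : Set ℂ) volume) {C : NNReal}
    (hφ : LipschitzOnWith C φ (N : Set ℂ))
    (hd : ∀ᵐ z, z ∈ N → ∀ v : ℂ, HasLineDerivAt ℝ φ (Φ z * v).re z v) :
    functionDistribution N (fun z => Φ z / 2) =
      distribDz (functionDistribution N fun z => (φ z : ℂ)) := by
  have hΦ2 : LocallyIntegrableOn (fun z => Φ z / 2) (N : Set ℂ) volume := hΦ.div_const 2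
  have hφc : LocallyIntegrableOn (fun z => (φ z : ℂ)) (N : Set ℂ) volume :=
    (Complex.continuous_ofReal.comp_continuousOn hφ.continuousOn).locallyIntegrableOn
      N.isOpen.measurableSet
  -- Integration by parts is used for Lipschitz functions on the whole plane; the extension does not
  -- affect pairings with test functions supported in `N`.
  obtain ⟨φ', hφ', heq⟩ := hφ.extend_real
  ext ψ
  have hψ1 : ContDiff ℝ 1 (ψ : ℂ → ℝ) := ψ.contDiff.of_le (by exact_mod_cast le_top)
  obtain ⟨D, hD⟩ := hψ1.lipschitzWith_of_hasCompactSupport ψ.hasCompactSupport one_ne_zero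
  have hint : Integrable fun z => (ψ z : ℂ) * Φ z :=
    integrable_mul_of_tsupport_subset (contDiff_ofReal_comp hψ1).continuous
      (hasCompactSupport_ofReal_comp ψ.hasCompactSupport)
      ((tsupport_ofReal_comp_subset _).trans ψ.tsupport_subset) hΦ
  have hline : ∀ v : ℂ, (∂_{v} (functionDistribution N fun z => (φ z : ℂ))) ψ =
      (((∫ z, (ψ z : ℂ) * Φ z) * v).re : ℂ) := by
    intro v
    rw [Distribution.lineDerivOp_apply_apply, map_neg, functionDistribution_apply hφc]
    have hψv : ∀ z, (∂_{v} ψ) z = lineDeriv ℝ ψ z v := by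
      intro z
      rw [TestFunction.lineDerivOp_eq_lineDerivCLM ℝ,
        TestFunction.lineDerivCLM_apply_of_le (by simp)]
    have hzero : ∀ z ∉ (N : Set ℂ), lineDeriv ℝ ψ z v = 0 := by
      intro z hz
      rw [(hψ1.differentiable one_ne_zero z).lineDeriv_eq_fderiv,
        image_eq_zero_of_notMem_tsupport fun h => hz
          (ψ.tsupport_subset (tsupport_fderiv_subset ℝ h))]
      rfl
    have e1 : ∫ z, (∂_{v} ψ) z • (φ z : ℂ) = ((∫ z, lineDeriv ℝ ψ z v * φ' z : ℝ) : ℂ) := by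
      rw [← integral_complex_ofReal]
      congr 1 with z
      rw [hψv]
      by_cases hz : z ∈ (N : Set ℂ)
      · simp [heq hz]
      · simp [hzero z hz]
    have e2 := hφ'.integral_lineDeriv_mul_eq (μ := volume) hD ψ.hasCompactSupport v
    have e3 : ∫ z, lineDeriv ℝ ψ z (-v) * φ' z = -∫ z, lineDeriv ℝ ψ z v * φ' z := by
      rw [← integral_neg]
      congr 1 with z
      rw [lineDeriv_neg, neg_mul]
    have e4 : ∫ z, lineDeriv ℝ φ' z v * ψ z = ((∫ z, (ψ z : ℂ) * Φ z) * v).re := by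
      rw [← integral_mul_const]
      have := integral_re (𝕜 := ℂ) (hint.mul_const v)
      change _ = (∫ w, (ψ w : ℂ) * Φ w * v).re at this
      rw [← this]
      refine integral_congr_ae ?_
      filter_upwards [hd] with z hz
      change _ = ((ψ z : ℂ) * Φ z * v).re
      rw [mul_assoc, Complex.re_ofReal_mul, mul_comm]
      by_cases hzN : z ∈ N
      · have h1 : φ' =ᶠ[nhds z] φ := by
          filter_upwards [N.isOpen.mem_nhds hzN] with w hw using (heq hw).symm
        rw [((hz hzN v).congr_of_eventuallyEq h1).lineDeriv]
      · rw [image_eq_zero_of_notMem_tsupport fun h => hzN (ψ.tsupport_subset h), zero_mul,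
          zero_mul]
    rw [e1, ← e4, e2, e3]
    push_cast
    ring
  have hdz : distribDz (functionDistribution N fun z => (φ z : ℂ)) ψ = (1 / 2 : ℂ) •
      ((∂_{(1 : ℂ)} (functionDistribution N fun z => (φ z : ℂ))) ψ -
        Complex.I • (∂_{Complex.I} (functionDistribution N fun z => (φ z : ℂ))) ψ) := rfl
  rw [hdz, hline, hline, functionDistribution_apply hΦ2]
  have e : ∫ z, ψ z • (Φ z / 2) = (1 / 2 : ℂ) * ∫ z, (ψ z : ℂ) * Φ z := by
    rw [← integral_const_mul]
    congr 1 with z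
    rw [Complex.real_smul]
    ring
  rw [e, smul_eq_mul, smul_eq_mul]
  congr 1
  -- What remains is the identity `G = Re G - I * Re (G * I)`.
  generalize ∫ z, (ψ z : ℂ) * Φ z = G
  apply Complex.ext <;> simp

/-! ### The theorem -/

theorem mainTheorem4 (U : Opens ℂ) (hU : IsSimplyConnected (U : Set ℂ))
    (Φ : ℂ → ℂ) (r : ℕ) (A : Fin r → ℂ → ℂ) (hΦA : IsCanonicalPA U Φ A)
    (f : Fin r → ℂ → ℂ) (hf : ∀ i, ∀ z ∈ U, HasDerivAt (f i) (A i z) z)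
    (hΦ : functionDistribution U Φ ∈ SigmaClass U)
    (h_triple : ∀ j k l : Fin r, j < k → k < l →
      Measure.hausdorffMeasure 1 ((U : Set ℂ) ∩ (frontier (canonicalPiece U Φ (A j)) ∩
        frontier (canonicalPiece U Φ (A k)) ∩ frontier (canonicalPiece U Φ (A l)))) = 0)
    (h_cone : ∀ p ∈ U, 1 < (activeIndices U Φ A p).card →
      ∀ k ∈ activeIndices U Φ A p, (0 : ℂ) ∉ differenceCone U Φ A p k) :
    ∀ p ∈ U, ∃ N : Opens ℂ, p ∈ N ∧ N ≤ U ∧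
      AEEqTwoDz N Φ (maxHarmonic (activeIndices U Φ A p) f p) := by
  intro p hp
  have h := hΦA.isMaximalPartition hU.isPathConnected.isConnected.isPreconnected
  have hloc := hΦA.locallyIntegrable
  have hmemI : ∀ j, j ∈ activeIndices U Φ A p ↔ p ∈ closure (canonicalPiece U Φ (A j)) := by
    simp [activeIndices]
  have hE : ∀ i j k, i ≠ j → i ≠ k → j ≠ k → Measure.hausdorffMeasure 1
      ((U : Set ℂ) ∩ (frontier (canonicalPiece U Φ (A i)) ∩ frontier (canonicalPiece U Φ (A j)) ∩
        frontier (canonicalPiece U Φ (A k)))) = 0 := by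
    intro i j k hij hik hjk
    rcases hij.lt_or_gt with h1 | h1 <;> rcases hik.lt_or_gt with h2 | h2 <;>
      rcases hjk.lt_or_gt with h3 | h3
    · exact h_triple i j k h1 h3
    · exact measure_mono_null (by tauto_set) (h_triple i k j h2 h3)
    · exact absurd (h1.trans h3) h2.asymm
    · exact measure_mono_null (by tauto_set) (h_triple k i j h2 h1)
    · exact measure_mono_null (by tauto_set) (h_triple j i k h1 h2)
    · exact absurd (h3.trans h1) h2.asymm
    · exact measure_mono_null (by tauto_set) (h_triple j k i h3 h2)
    · exact measure_mono_null (by tauto_set) (h_triple k j i h3 h1)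
  have hcone : ∀ k, p ∈ closure (canonicalPiece U Φ (A k)) → ∃ v : ℂ, ∀ j,
      p ∈ closure (canonicalPiece U Φ (A j)) → j ≠ k → 0 < ((A k p - A j p) * v).re := by
    intro k hk
    obtain ⟨v, hv⟩ := exists_forall_re_mul_pos ((activeIndices U Φ A p).erase k)
      (fun j => A k p - A j p) fun θ hθ0 hθ h0 => by
        obtain ⟨j, hj⟩ : ((activeIndices U Φ A p).erase k).Nonempty := by
          rw [Finset.nonempty_iff_ne_empty]
          intro he
          simp [he] at hθ
        have hjI := Finset.mem_erase.1 hj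
        exact h_cone p hp (Finset.one_lt_card.2 ⟨j, hjI.2, k, (hmemI k).2 hk, hjI.1⟩) k
          ((hmemI k).2 hk) ⟨θ, hθ0, hθ, h0.symm⟩
    exact ⟨v, fun j hj hjk => hv j (Finset.mem_erase.2 ⟨hjk, (hmemI j).2 hj⟩)⟩
  obtain ⟨R, hR, hRU, hdisj, hmax⟩ := h.exists_ball_re_primitive_le U.isOpen hloc
    (dbarNonneg_of_mem_sigmaClass hloc hΦ) hΦA.analytic hf hE hp hcone
  have hI : (activeIndices U Φ A p).Nonempty := by
    obtain ⟨i, hi⟩ := h.exists_mem_closure U.isOpen hp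
    exact ⟨i, (hmemI i).2 hi⟩
  have hball : Metric.ball p R ⊆ U := Metric.ball_subset_closedBall.trans hRU
  obtain ⟨C, hC⟩ := exists_lipschitzOnWith_maxHarmonic (p := p) hI (convex_closedBall p R)
    (isCompact_closedBall p R) (fun i z hz => hf i z (hRU hz))
    fun i => (hΦA.analytic i).continuousOn.mono hRU
  have hlocN : LocallyIntegrableOn Φ (Metric.ball p R) volume := hloc.mono_set hball
  refine ⟨⟨Metric.ball p R, Metric.isOpen_ball⟩, Metric.mem_ball_self hR, hball,
    fun z => Φ z / 2, ?_, ?_, ?_⟩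
  · exact hlocN.div_const 2
  · refine functionDistribution_half_eq_distribDz hlocN
      (hC.mono Metric.ball_subset_closedBall) ?_
    filter_upwards [h.ae_cover, Filter.eventually_all.2 h.ae_eq] with z hz hzA hzN v
    replace hzN : z ∈ Metric.ball p R := hzN
    obtain ⟨k, hk⟩ := hz (hball hzN)
    have hkI : p ∈ closure (canonicalPiece U Φ (A k)) := by
      by_contra hkI
      exact Set.disjoint_left.1 (hdisj k hkI) hzN hk
    -- Because `M k` is open, the maximum coincides with `H_k` on a whole neighbourhood of `z`, so
    -- their derivatives agree there.
    have heq : maxHarmonic (activeIndices U Φ A p) f p =ᶠ[nhds z]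
        fun w => (f k w - f k p).re := by
      filter_upwards [(h.isOpen k).mem_nhds hk, Metric.isOpen_ball.mem_nhds hzN] with w hwk hwN
      refine le_antisymm (maxHarmonic_le hI fun j hj => ?_)
        (harmonicFromPrimitive_le_maxHarmonic ((hmemI k).2 hkI) w)
      exact hmax k j hkI ((hmemI j).1 hj) w ⟨hwk, hwN⟩
    rw [hzA k hk]
    have hd : HasFDerivAt (fun w => (f k w - f k p).re)
        (Complex.reCLM ∘L ((ContinuousLinearMap.toSpanSingleton ℂ (A k z)).restrictScalars ℝ)) z :=
      Complex.reCLM.hasFDerivAt.comp z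
        (((hf k z (hball hzN)).sub_const (f k p)).hasFDerivAt.restrictScalars ℝ)
    have hval : (Complex.reCLM ∘L ((ContinuousLinearMap.toSpanSingleton ℂ
        (A k z)).restrictScalars ℝ)) v = (A k z * v).re := by
      simp [mul_comm]
    exact hval ▸ (hd.congr_of_eventuallyEq heq).hasLineDerivAt v
  · exact Filter.Eventually.of_forall fun z => by ring
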